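/- Let $H$ and $G$ be real Hilbert spaces, let $L:H\to G$ be a bounded linear operator with adjoint $L^*$, and let $C\subset H$ and $Q\subset G$ be nonempty closed convex sets. Let $\Omega=\{x\in C : Lx\in Q\}$ be the solution set of the split feasibility problem, and assume $\Omega\neq\emptyset$. Let $P_Q$ be the metric projection onto $Q$. For $\alpha>0$ let $\mathcal P_\alpha(H)$ be the set of bounded self-adjoint operators $U$ on $H$ with $U\succeq\alpha I$ (where $U\succeq V$ means that $\langle Ux,x\rangle\ge\langle Vx,x\rangle$ for all $x\in H$). For such $U$ put $\|x\|_{U^{-1}}=\sqrt{\langle U^{-1}x,x\rangle}$ and $P_C^{U^{-1}}(x)=\arg\min_{y\in C}\|x-y\|_{U^{-1}}$. Let $\beta>0$ satisfy $\beta\|L\|^2\le 1$ (for $L\ne0$ one may take $\beta=1/\|L\|^2$). Let $\alpha>0$, let $(\eta_k)_{k\ge 0}$ be a summable sequence in $[0,+\infty)$, and let $(U_k)_{k\ge 0}$ be a sequence in $\mathcal P_\alpha(H)$ with $$\mu:=\sup_{k}\|U_k\|<+\infty,\qquad (1+\eta_k)U_{k+1}\succeq U_k\quad\text{for all }k\ge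 0 .$$ For every $k$ let $\gamma_k>0$ with $\gamma_k\|U_k\|<2\beta$, put $\alpha_k=\frac{2\beta}{4\beta-\gamma_k\|U_k\|}$, and let $0<\lambda_k<\frac1{\alpha_k}$. Let $(a_k)$ and $(b_k)$ be sequences in $H$ with $\sum_k\lambda_k\|a_k\|<+\infty$ and $\sum_k\lambda_k\|b_k\|<+\infty$. Write $B(x)=L^*(Lx-P_Q(Lx))$, let $x_0\in H$, and define, for $k\ge 0$, $$y_k=x_k-\gamma_kU_k\big(B(x_k)+b_k\big),\qquad x_{k+1}=x_k+\lambda_k\big(P_C^{U_k^{-1}}(y_k)+a_k-x_k\big).$$ Consider the assertions: (i) for every $x^*\in\Omega$, $\lim_{k\to\infty}\|x_k-x^*\|_{U_k^{-1}}$ exists; (ii) $\lim_{k\to\infty}\big\|x_k-P_C^{U_k^{-1}}\big(x_k-\gamma_kU_kB(x_k)\big)\big\|=0$; (iii) $(x_k)$ converges weakly to a point of $\Omega$; (iv) $B(x_k)\to B(x^*)$ in norm, for every $x^*\in\Omega$. Then (i) holds. Moreover: (1) Suppose that there are $\underline\lambda>0$ and $\tau>0$ with $\underline\lambda\le\lambda_k\le\frac1{\alpha_k}-\tau$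 for all $k$. Then (ii) holds. If in addition $\gamma_k\ge\underline\gamma$ for all $k$, for some $\underline\gamma>0$, then (iii) holds. If furthermore $\gamma_k\mu\le2\beta-\varepsilon$ for all $k$, for some $\varepsilon>0$, then (iv) holds. (2) Suppose that (a) $\sum_k\lambda_k\big(\frac1{\alpha_k}-\lambda_k\big)=+\infty$; (b) there are $\underline\gamma>0$ and $\varepsilon>0$ with $\underline\gamma\le\gamma_k$ and $\gamma_k\mu\le2\beta-\varepsilon$ for all $k$; (c) $\sum_k|\gamma_{k+1}-\gamma_k|<+\infty$, $\sum_k\big|\gamma_{k+1}\|U_{k+1}\|-\gamma_k\|U_k\|\big|<+\infty$, and $\sum_k\|U_k^{-1}x-U_{k+1}^{-1}x\|<+\infty$ for every $x\in H$. Then (ii) and (iii) hold. If in addition $\lambda_k\ge\underline\lambda$ for all $k$, for some $\underline\lambda>0$, then (iv) holds. -/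

import Mathlib

open Filter Topology
open scoped RealInnerProductSpace

noncomputable section

namespace VMSFP

variable {H : Type*} [NormedAddCommGroup H] [InnerProductSpace ℝ H]
variable {G : Type*} [NormedAddCommGroup G] [InnerProductSpace ℝ G]

/-- The class `𝒫_α(H)`: bounded self-adjoint operators `U` with `α I ≼ U` in the Loewner order
(Mathlib's order on `H →L[ℝ] H`: `S ≤ T` iff `T - S` is a positive operator). -/
def PosClass (H : Type*) [NormedAddCommGroup H] [InnerProductSpace ℝ H] [CompleteSpace H]
    (α : ℝ) : Set (H →L[ℝ] H) :=
  {U | IsSelfAdjoint U ∧ α • ContinuousLinearMap.id ℝ H ≤ U}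

/-- The (semi-)norm `‖x‖_W = √⟨W x, x⟩` induced by a positive operator `W`. -/
def wnorm (W : H →L[ℝ] H) (x : H) : ℝ := √⟪W x, x⟫

/-- `p` is a nearest point of `C` to `x` for the metric `‖·‖_W`. -/
def IsProjPt (W : H →L[ℝ] H) (C : Set H) (x p : H) : Prop :=
  p ∈ C ∧ ∀ y ∈ C, wnorm W (x - p) ≤ wnorm W (x - y)

open Classical in
/-- The projector `P_C^W(x) = argmin_{y ∈ C} ‖x - y‖_W`. For a nonempty closed convex `C` and
`W ∈ 𝒫_α(H)` with `α > 0` the minimizer exists and is unique; where there is no minimizer,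
the value is `x`. -/
def wproj (W : H →L[ℝ] H) (C : Set H) (x : H) : H :=
  if h : ∃ p, IsProjPt W C x p then h.choose else x

/-- The metric projection `P_Q(z) = argmin_{y ∈ Q} ‖z - y‖`, that is, the projector
relative to the metric of the identity. -/
def mproj (Q : Set G) (z : G) : G := wproj (ContinuousLinearMap.id ℝ G) Q z

/-- The solution set of the split feasibility problem: find `x ∈ C` with `L x ∈ Q`. -/
def sfpSol (L : H →L[ℝ] G) (C : Set H) (Q : Set G) : Set H := {x | x ∈ C ∧ L x ∈ Q}

/-- The operator `x ↦ L* (L x - P_Q (L x))`. -/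
def sfpGrad [CompleteSpace H] [CompleteSpace G] (L : H →L[ℝ] G) (Q : Set G) (x : H) : H :=
  L.adjoint (L x - mproj Q (L x))

/-- The constant `2β / (4β - γ ‖U‖)`. -/
def avgConst (β γ : ℝ) (U : H →L[ℝ] H) : ℝ := 2 * β / (4 * β - γ * ‖U‖)

/-- The residual `‖x - P_C^{U⁻¹}(x - γ U L*(L x - P_Q (L x)))‖`. -/
def residual [CompleteSpace H] [CompleteSpace G] (L : H →L[ℝ] G) (C : Set H) (Q : Set G)
    (U : H →L[ℝ] H) (γ : ℝ) (x : H) : ℝ :=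
  ‖x - wproj U.inverse C (x - γ • U (sfpGrad L Q x))‖

end VMSFP

end

/-! Write `p k` for the exact forward-backward point `fwdBwd` at `x k`, and `u k = x k - p k`; the
residual is `‖u k‖`. Projections in the metric of `(U k)⁻¹` are Lipschitz, uniformly in `k`, so both
error sequences merge into one perturbation that stays summable after weighting by `lam k`
(`exists_error`). The unperturbed step lowers the squared distance to a solution, in that metric, by
exactly `lam (1/α_k - lam) ‖u‖² + 2 lam slack` (`wnorm_relaxed_step_sq`). The slack is nonnegative:
it is a sum of nonnegative terms (`slack_eq`). Since the metrics grow by a factor of at most `1 + η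
k`, this gives a quasi-Fejér inequality, hence (i), and the decreases are summable
(`summable_decrease`).

For relaxation parameters away from both ends, the first part of the decrease already forces the
residual to zero. Under the divergence condition `lam` may approach `1/α_k` or `0`, and the slack
does the work: a residual bounded below forces a slack bounded below (`exists_le_slack`). Hence the
indices with a large residual carry finite `lam`-mass, while the total mass is infinite. Oscillation
is excluded by passing to `naturalResidual`, which involves no metric: it is Lipschitz along the
iterates, is comparable with the residual, and falls under `tendsto_zero_of_summable_indicator`.

Once the residual vanishes, so does `‖L x - P_Q (L x)‖` (`tendsto_norm_sub_mproj`). This yields (iv)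
and shows that weak cluster points are solutions. They coincide by Opial's argument, which works for
moving metrics because the operators `(U k)⁻¹` converge strongly (`exists_tendsto_inverse`). -/

noncomputable section

/-! ### Quadratic forms and metrics given by positive operators. -/

namespace VMSFP

variable {H : Type*} [NormedAddCommGroup H] [InnerProductSpace ℝ H]

/-- `W` is symmetric with `m ‖v‖² ≤ ⟪W v, v⟫` and `‖W v‖² ≤ M ⟪W v, v⟫`. -/
structure IsMetric (W : H →L[ℝ] H) (m M : ℝ) : Prop where
  symm : ∀ v w, ⟪W v, w⟫ = ⟪v, W w⟫
  lower : ∀ v, m * ‖v‖ ^ 2 ≤ ⟪W v, v⟫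
  upper : ∀ v, ‖W v‖ ^ 2 ≤ M * ⟪W v, v⟫
  m_pos : 0 < m
  M_pos : 0 < M

/-- Cauchy–Schwarz for a semidefinite form: the quadratic `t ↦ ⟪T (v + t w), v + t w⟫` has
nonpositive discriminant. -/
theorem inner_sq_le_of_nonneg {T : H →L[ℝ] H} (hs : ∀ v w, ⟪T v, w⟫ = ⟪v, T w⟫)
    (hp : ∀ v, 0 ≤ ⟪T v, v⟫) (v w : H) : ⟪T v, w⟫ ^ 2 ≤ ⟪T v, v⟫ * ⟪T w, w⟫ := by
  have h : ∀ t : ℝ, 0 ≤ ⟪T w, w⟫ * (t * t) + (2 * ⟪T v, w⟫) * t + ⟪T v, v⟫ := by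
    intro t
    have h1 := hp (v + t • w)
    have h2 : ⟪T w, v⟫ = ⟪T v, w⟫ := by rw [hs, real_inner_comm]
    simp only [map_add, map_smul, inner_add_left, inner_add_right, inner_smul_left,
      inner_smul_right, h2, RCLike.conj_to_real] at h1
    linarith
  have := discrim_le_zero h
  unfold discrim at this
  nlinarith

/-- Cauchy–Schwarz with `w = T v`. It turns smallness of the quadratic form into smallness of the
vector `T v`. -/
theorem norm_sq_apply_le_of_nonneg {T : H →L[ℝ] H} (hs : ∀ v w, ⟪T v, w⟫ = ⟪v, T w⟫)
    (hp : ∀ v, 0 ≤ ⟪T v, v⟫) (v : H) : ‖T v‖ ^ 2 ≤ ‖T‖ * ⟪T v, v⟫ := by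
  have h := inner_sq_le_of_nonneg hs hp v (T v)
  rw [real_inner_self_eq_norm_sq] at h
  have h2 : ⟪T (T v), T v⟫ ≤ ‖T‖ * ‖T v‖ ^ 2 := by
    have := real_inner_le_norm (T (T v)) (T v)
    have h3 := T.le_opNorm (T v)
    nlinarith [norm_nonneg (T v)]
  rcases eq_or_ne (T v) 0 with h0 | h0
  · simp [h0]
  · have h4 : 0 < ‖T v‖ ^ 2 := by positivity
    have h5 : ⟪T v, v⟫ * ⟪T (T v), T v⟫ ≤ ⟪T v, v⟫ * (‖T‖ * ‖T v‖ ^ 2) :=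
      mul_le_mul_of_nonneg_left h2 (hp v)
    have : ‖T v‖ ^ 2 * ‖T v‖ ^ 2 ≤ (‖T‖ * ⟪T v, v⟫) * ‖T v‖ ^ 2 := by nlinarith
    exact le_of_mul_le_mul_right this h4

namespace IsMetric

variable {W : H →L[ℝ] H} {m M : ℝ}

theorem id : IsMetric (ContinuousLinearMap.id ℝ H) 1 1 :=
  ⟨fun _ _ => rfl, fun v => by simp, fun v => by simp, one_pos, one_pos⟩

theorem nonneg (hW : IsMetric W m M) (v : H) : 0 ≤ ⟪W v, v⟫ :=
  le_trans (mul_nonneg hW.m_pos.le (sq_nonneg _)) (hW.lower v)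

theorem norm_apply_le (hW : IsMetric W m M) (v : H) : ‖W v‖ ≤ M * ‖v‖ := by
  have h1 := hW.upper v
  have h2 := real_inner_le_norm (W v) v
  have hM := hW.M_pos
  by_contra! h
  have : 0 < ‖W v‖ := lt_of_le_of_lt (by positivity) h
  nlinarith

theorem inner_self_le (hW : IsMetric W m M) (v : H) : ⟪W v, v⟫ ≤ M * ‖v‖ ^ 2 := by
  have h2 := real_inner_le_norm (W v) v
  have := hW.norm_apply_le v
  nlinarith [norm_nonneg v]

theorem wnorm_nonneg (W : H →L[ℝ] H) (v : H) : 0 ≤ wnorm W v := Real.sqrt_nonneg _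

theorem wnorm_sq (hW : IsMetric W m M) (v : H) : wnorm W v ^ 2 = ⟪W v, v⟫ :=
  Real.sq_sqrt (hW.nonneg v)

theorem inner_le_wnorm (hW : IsMetric W m M) (v w : H) : ⟪W v, w⟫ ≤ wnorm W v * wnorm W w := by
  have h := inner_sq_le_of_nonneg hW.symm hW.nonneg v w
  rw [← hW.wnorm_sq, ← hW.wnorm_sq, ← mul_pow] at h
  exact le_of_sq_le_sq h (mul_nonneg (wnorm_nonneg _ _) (wnorm_nonneg _ _))

theorem inner_comm (hW : IsMetric W m M) (v w : H) : ⟪W w, v⟫ = ⟪W v, w⟫ := by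
  rw [hW.symm, real_inner_comm]

theorem inner_sub_self (hW : IsMetric W m M) (v w : H) :
    ⟪W (v - w), v - w⟫ = ⟪W v, v⟫ - 2 * ⟪W v, w⟫ + ⟪W w, w⟫ := by
  rw [map_sub, inner_sub_left, inner_sub_right, inner_sub_right, hW.inner_comm v w]
  ring

theorem wnorm_add_le (hW : IsMetric W m M) (v w : H) :
    wnorm W (v + w) ≤ wnorm W v + wnorm W w := by
  refine le_of_sq_le_sq ?_ (add_nonneg (wnorm_nonneg _ _) (wnorm_nonneg _ _))
  have h := hW.inner_le_wnorm v w
  have h1 := hW.wnorm_sq v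
  have h2 := hW.wnorm_sq w
  rw [hW.wnorm_sq, map_add, inner_add_left, inner_add_right, inner_add_right, hW.inner_comm v w]
  nlinarith

theorem wnorm_le (hW : IsMetric W m M) (v : H) : wnorm W v ≤ √M * ‖v‖ := by
  refine le_of_sq_le_sq ?_ (by positivity)
  rw [hW.wnorm_sq, mul_pow, Real.sq_sqrt hW.M_pos.le]
  exact hW.inner_self_le v

theorem le_wnorm (hW : IsMetric W m M) (v : H) : √m * ‖v‖ ≤ wnorm W v := by
  refine le_of_sq_le_sq ?_ (wnorm_nonneg _ _)
  rw [hW.wnorm_sq, mul_pow, Real.sq_sqrt hW.m_pos.le]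
  exact hW.lower v

end IsMetric

/-! ### Projections in a metric, through their variational inequality. -/

theorem exists_nearest {K : Type*} [NormedAddCommGroup K] [InnerProductSpace ℝ K] [CompleteSpace K]
    {C : Set K} (hne : C.Nonempty) (hcl : IsClosed C) (hcv : Convex ℝ C) (x : K) :
    ∃ p ∈ C, ∀ y ∈ C, ⟪x - p, y - p⟫ ≤ 0 := by
  obtain ⟨p, hp, h⟩ := exists_norm_eq_iInf_of_complete_convex hne hcl.isComplete hcv x
  exact ⟨p, hp, (norm_eq_iInf_iff_real_inner_le_zero hcv hp).1 h⟩

/-- The variational inequality that characterizes `p` as the projection of `x` onto `C` for the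
metric of `W`. -/
def SolvesVI (W : H →L[ℝ] H) (C : Set H) (x p : H) : Prop :=
  p ∈ C ∧ ∀ y ∈ C, ⟪W (x - p), y - p⟫ ≤ 0

theorem SolvesVI.isProjPt {W : H →L[ℝ] H} {m M : ℝ} (hW : IsMetric W m M) {C : Set H} {x p : H}
    (h : SolvesVI W C x p) : IsProjPt W C x p := by
  refine ⟨h.1, fun y hy => Real.sqrt_le_sqrt ?_⟩
  have h1 := h.2 y hy
  have h2 := hW.nonneg (y - p)
  have h3 : x - y = (x - p) - (y - p) := by abel
  rw [h3, hW.inner_sub_self (x - p)]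
  linarith

theorem IsProjPt.solvesVI {W : H →L[ℝ] H} {m M : ℝ} (hW : IsMetric W m M) {C : Set H}
    (hcv : Convex ℝ C) {x p : H} (h : IsProjPt W C x p) : SolvesVI W C x p := by
  refine ⟨h.1, fun y hy => ?_⟩
  have key : ∀ t : ℝ, 0 < t → t ≤ 1 → 2 * ⟪W (x - p), y - p⟫ ≤ t * ⟪W (y - p), y - p⟫ := by
    intro t ht ht1
    have hmem : p + t • (y - p) ∈ C := hcv.add_smul_sub_mem h.1 hy ⟨ht.le, ht1⟩
    have h1 := h.2 _ hmem
    have h2 : wnorm W (x - p) ^ 2 ≤ wnorm W (x - (p + t • (y - p))) ^ 2 :=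
      pow_le_pow_left₀ (IsMetric.wnorm_nonneg _ _) h1 2
    have h3 : x - (p + t • (y - p)) = (x - p) - t • (y - p) := by abel
    rw [h3, hW.wnorm_sq, hW.wnorm_sq, hW.inner_sub_self (x - p), map_smul, inner_smul_right,
      inner_smul_left, inner_smul_right] at h2
    simp only [RCLike.conj_to_real] at h2
    have : t * (2 * ⟪W (x - p), y - p⟫) ≤ t * (t * ⟪W (y - p), y - p⟫) := by linarith
    exact le_of_mul_le_mul_left this ht
  by_contra! hpos
  set A := ⟪W (x - p), y - p⟫
  set D := ⟪W (y - p), y - p⟫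
  have hD : 0 ≤ D := hW.nonneg _
  -- This `t` is at most `1` and satisfies `t * D ≤ A`, which contradicts `2 * A ≤ t * D` for `A >
  -- 0`; adding `A` to the denominator also covers `D = 0`.
  have := key (A / (A + D)) (by positivity) (by rw [div_le_one (by positivity)]; linarith)
  have h2 : A / (A + D) * D ≤ A := by
    rw [div_mul_eq_mul_div, div_le_iff₀ (by positivity)]
    nlinarith
  linarith

/-- Each inequality is tested at the other solution and the two are added. Measuring in the original
norm costs the condition number `M / m`. -/
theorem SolvesVI.dist_le {W : H →L[ℝ] H} {m M : ℝ} (hW : IsMetric W m M) {C : Set H}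
    {x p x' p' : H} (h : SolvesVI W C x p) (h' : SolvesVI W C x' p') :
    ‖p - p'‖ ≤ M / m * ‖x - x'‖ := by
  have h1 := h.2 p' h'.1
  have h2 := h'.2 p h.1
  have h3 := hW.lower (p - p')
  have h4 : ⟪W (p - p'), p - p'⟫ ≤ ⟪W (x - x'), p - p'⟫ := by
    have e1 : ⟪W (x - p), p' - p⟫ = - ⟪W (x - p), p - p'⟫ := by rw [← inner_neg_right, neg_sub]
    have e2 : ⟪W (x - x'), p - p'⟫ - ⟪W (p - p'), p - p'⟫ =
        ⟪W (x - p), p - p'⟫ - ⟪W (x' - p'), p - p'⟫ := by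
      rw [← inner_sub_left, ← inner_sub_left, ← map_sub, ← map_sub]
      congr 2; abel
    linarith
  have h5 := real_inner_le_norm (W (x - x')) (p - p')
  have h6 := hW.norm_apply_le (x - x')
  have hm := hW.m_pos
  rw [div_mul_eq_mul_div, le_div_iff₀ hm]
  rcases (norm_nonneg (p - p')).eq_or_lt with h0 | h0
  · rw [← h0, zero_mul]; exact le_trans (norm_nonneg _) h6
  · nlinarith

section Complete

variable [CompleteSpace H]

/-- Solutions are the fixed points of `p ↦ P_C (p + t W (x - p))`, with `P_C` the ordinary
projection. For `t = 1 / M` this is a contraction with constant `√(1 - m / M)`. -/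
theorem exists_solvesVI {W : H →L[ℝ] H} {m M : ℝ} (hW : IsMetric W m M) {C : Set H}
    (hne : C.Nonempty) (hcl : IsClosed C) (hcv : Convex ℝ C) (x : H) :
    ∃ p, SolvesVI W C x p := by
  choose P hP hPv using exists_nearest hne hcl hcv
  have hm := hW.m_pos
  have hM := hW.M_pos
  set t : ℝ := 1 / M with ht
  have htpos : 0 < t := by positivity
  set c : ℝ := √(1 - t * m) with hc
  have hc1 : c < 1 := by
    rw [hc, Real.sqrt_lt' one_pos]
    nlinarith [mul_pos htpos hm]
  let F : H → H := fun p => P (p + t • W (x - p))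
  have hF : ContractingWith ⟨c, Real.sqrt_nonneg _⟩ F := by
    refine ⟨by exact_mod_cast hc1, LipschitzWith.of_dist_le_mul fun p p' => ?_⟩
    rw [dist_eq_norm, dist_eq_norm]
    have h1 := SolvesVI.dist_le IsMetric.id (C := C)
      (⟨hP _, hPv _⟩ : SolvesVI _ C (p + t • W (x - p)) (F p))
      (⟨hP _, hPv _⟩ : SolvesVI _ C (p' + t • W (x - p')) (F p'))
    have e : p + t • W (x - p) - (p' + t • W (x - p')) = (p - p') - t • W (p - p') := by
      simp only [map_sub, smul_sub]; abel
    rw [e, div_one, one_mul] at h1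
    refine h1.trans ?_
    refine le_of_sq_le_sq ?_ (mul_nonneg (Real.sqrt_nonneg _) (norm_nonneg _))
    have h2 := hW.upper (p - p')
    have h3 := hW.lower (p - p')
    rw [norm_sub_sq_real, inner_smul_right, norm_smul, mul_pow, Real.norm_of_nonneg htpos.le,
      real_inner_comm]
    have h4 : t ^ 2 * ‖W (p - p')‖ ^ 2 ≤ t * ⟪W (p - p'), p - p'⟫ := by
      have : t ^ 2 * (M * ⟪W (p - p'), p - p'⟫) = t * ⟪W (p - p'), p - p'⟫ := by
        rw [ht]; field_simp
      rw [← this]; gcongr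
    have h5 : t * (m * ‖p - p'‖ ^ 2) ≤ t * ⟪W (p - p'), p - p'⟫ := by gcongr
    change _ ≤ (c * ‖p - p'‖) ^ 2
    rcases le_or_gt 0 (1 - t * m) with h6 | h6
    · rw [mul_pow, hc, Real.sq_sqrt h6]
      nlinarith
    -- Here `m > M`, which can only happen in the zero space; the root is then `0`.
    · rw [mul_pow, hc, Real.sqrt_eq_zero_of_nonpos h6.le]
      nlinarith [sq_nonneg ‖p - p'‖]
  obtain ⟨p, hp⟩ : ∃ p, F p = p := ⟨_, hF.fixedPoint_isFixedPt⟩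
  refine ⟨p, ?_, fun y hy => ?_⟩
  · rw [← hp]; exact hP _
  · have h := hPv (p + t • W (x - p)) y hy
    have hp' : P (p + t • W (x - p)) = p := hp
    rw [hp', add_sub_cancel_left, inner_smul_left] at h
    simp only [RCLike.conj_to_real] at h
    exact nonpos_of_mul_nonpos_right h htpos

theorem wproj_solvesVI {W : H →L[ℝ] H} {m M : ℝ} (hW : IsMetric W m M) {C : Set H}
    (hne : C.Nonempty) (hcl : IsClosed C) (hcv : Convex ℝ C) (x : H) :
    SolvesVI W C x (wproj W C x) := by
  obtain ⟨p, hp⟩ := exists_solvesVI hW hne hcl hcv x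
  have h : ∃ p, IsProjPt W C x p := ⟨p, hp.isProjPt hW⟩
  rw [wproj, dif_pos h]
  exact h.choose_spec.solvesVI hW hcv

theorem mproj_solvesVI {Q : Set H} (hne : Q.Nonempty) (hcl : IsClosed Q) (hcv : Convex ℝ Q)
    (z : H) : mproj Q z ∈ Q ∧ ∀ y ∈ Q, ⟪z - mproj Q z, y - mproj Q z⟫ ≤ 0 :=
  wproj_solvesVI IsMetric.id hne hcl hcv z

/-! ### The class `𝒫_α` and the inverses of its members. -/

theorem PosClass.lower {α : ℝ} {U : H →L[ℝ] H} (hU : U ∈ PosClass H α) (v : H) :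
    α * ‖v‖ ^ 2 ≤ ⟪U v, v⟫ := by
  have := hU.2.inner_nonneg_left v
  simp only [sub_apply, smul_apply,
    ContinuousLinearMap.id_apply, inner_sub_left, inner_smul_left, RCLike.conj_to_real,
    real_inner_self_eq_norm_sq] at this
  linarith

theorem PosClass.symm {α : ℝ} {U : H →L[ℝ] H} (hU : U ∈ PosClass H α) (v w : H) :
    ⟪U v, w⟫ = ⟪v, U w⟫ := hU.1.isSymmetric v w

theorem PosClass.mul_norm_le {α : ℝ} {U : H →L[ℝ] H} (hU : U ∈ PosClass H α) (v : H) :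
    α * ‖v‖ ≤ ‖U‖ * ‖v‖ := by
  have h1 := PosClass.lower hU v
  have h2 := real_inner_le_norm (U v) v
  have h3 := U.le_opNorm v
  rcases (norm_nonneg v).eq_or_lt with h0 | h0
  · rw [← h0]; simp
  · nlinarith

theorem PosClass.isInvertible {α : ℝ} (hα : 0 < α) {U : H →L[ℝ] H} (hU : U ∈ PosClass H α) :
    U.IsInvertible := by
  obtain ⟨u, hu⟩ : IsUnit U := by
    refine ContinuousLinearMap.isUnit_of_forall_le_norm_inner_map U (c := ⟨α, hα.le⟩) hα fun v => ?_
    have := PosClass.lower hU v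
    rw [Real.norm_eq_abs]
    refine le_trans (le_of_eq ?_) (this.trans (le_abs_self _))
    rw [mul_comm]; rfl
  exact ⟨ContinuousLinearEquiv.unitsEquiv ℝ H u, hu⟩

variable {α : ℝ} {U : H →L[ℝ] H}

theorem PosClass.apply_inverse (hα : 0 < α) (hU : U ∈ PosClass H α) (v : H) :
    U (U.inverse v) = v := by
  obtain ⟨e, rfl⟩ := PosClass.isInvertible hα hU
  simp

theorem PosClass.inverse_apply (hα : 0 < α) (hU : U ∈ PosClass H α) (v : H) :
    U.inverse (U v) = v := by
  obtain ⟨e, rfl⟩ := PosClass.isInvertible hα hU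
  simp

theorem PosClass.norm_sq_le_inverse (hα : 0 < α) (hU : U ∈ PosClass H α) (v : H) :
    ‖v‖ ^ 2 ≤ ‖U‖ * ⟪U.inverse v, v⟫ := by
  have h := norm_sq_apply_le_of_nonneg (PosClass.symm hU)
    (fun v => (by positivity : 0 ≤ α * ‖v‖ ^ 2).trans (PosClass.lower hU v)) (U.inverse v)
  rwa [PosClass.apply_inverse hα hU, real_inner_comm] at h

theorem PosClass.isMetric_inverse (hα : 0 < α) (hU : U ∈ PosClass H α) {N : ℝ} (hN : 0 < N)
    (hUN : ‖U‖ ≤ N) : IsMetric U.inverse (1 / N) (1 / α) := by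
  have hpos : ∀ v, α * ‖U.inverse v‖ ^ 2 ≤ ⟪U.inverse v, v⟫ := fun v => by
    have := PosClass.lower hU (U.inverse v)
    rwa [PosClass.apply_inverse hα hU, real_inner_comm] at this
  refine ⟨fun v w => ?_, fun v => ?_, fun v => ?_, by positivity, by positivity⟩
  · have := PosClass.symm hU (U.inverse v) (U.inverse w)
    rw [PosClass.apply_inverse hα hU, PosClass.apply_inverse hα hU] at this
    exact this.symm
  · have h1 := PosClass.norm_sq_le_inverse hα hU v
    have h2 : 0 ≤ ⟪U.inverse v, v⟫ := le_trans (by positivity) (hpos v)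
    rw [div_mul_eq_mul_div, one_mul, div_le_iff₀ hN]
    nlinarith
  · rw [div_mul_eq_mul_div, one_mul, le_div_iff₀ hα]
    linarith [hpos v]

/-- Inversion reverses the Loewner order. Cauchy–Schwarz for the form of `U` at `U⁻¹ v` and `V⁻¹ v`
gives `⟪V⁻¹ v, v⟫² ≤ ⟪U⁻¹ v, v⟫ * ⟪U V⁻¹ v, V⁻¹ v⟫`; the last factor is at most `s * ⟪V⁻¹ v, v⟫`,
and one factor cancels. -/
theorem PosClass.inverse_le_of_le (hα : 0 < α) {V : H →L[ℝ] H} (hU : U ∈ PosClass H α)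
    (hV : V ∈ PosClass H α) {s : ℝ} (hUV : U ≤ s • V) (v : H) :
    ⟪V.inverse v, v⟫ ≤ s * ⟪U.inverse v, v⟫ := by
  have h := inner_sq_le_of_nonneg (PosClass.symm hU)
    (fun v => (by positivity : 0 ≤ α * ‖v‖ ^ 2).trans (PosClass.lower hU v))
    (U.inverse v) (V.inverse v)
  rw [PosClass.apply_inverse hα hU] at h
  have h2 := hUV.inner_nonneg_left (V.inverse v)
  simp only [sub_apply, smul_apply, inner_sub_left,
    inner_smul_left, RCLike.conj_to_real, PosClass.apply_inverse hα hV] at h2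
  have h3 : 0 ≤ ⟪V.inverse v, v⟫ :=
    -- The bound is `‖V‖ + 1` because `‖V‖` is zero in the zero space.
    (PosClass.isMetric_inverse hα hV (N := ‖V‖ + 1) (by positivity) (by linarith)).nonneg v
  have h4 : 0 ≤ ⟪U.inverse v, v⟫ :=
    (PosClass.isMetric_inverse hα hU (N := ‖U‖ + 1) (by positivity) (by linarith)).nonneg v
  rw [real_inner_comm] at h h2
  rw [real_inner_comm (U.inverse v) v] at h
  rcases h3.eq_or_lt with h0 | h0
  · rcases eq_or_ne v 0 with rfl | hv
    · simp
    · have := (PosClass.isMetric_inverse hα hV (N := ‖V‖ + 1) (by positivity) (by linarith)).lower v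
      have : 0 < 1 / (‖V‖ + 1) * ‖v‖ ^ 2 := by positivity
      linarith
  · nlinarith

end Complete

end VMSFP

/-! ### Real sequences with summable perturbations. -/

namespace VMSFP

/-- Discrete Grönwall: the products `∏ (1 + η j)` stay below `exp (∑ η j)`. -/
theorem bounded_of_le_one_add_mul {u η ε : ℕ → ℝ} (hu : ∀ k, 0 ≤ u k) (hη : ∀ k, 0 ≤ η k)
    (hε : ∀ k, 0 ≤ ε k) (hηs : Summable η) (hεs : Summable ε)
    (h : ∀ k, u (k + 1) ≤ (1 + η k) * u k + ε k) : ∃ M, ∀ k, u k ≤ M := by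
  have h1 : ∀ k, u k ≤ (∏ j ∈ Finset.range k, (1 + η j)) * (u 0 + ∑ j ∈ Finset.range k, ε j) := by
    intro k
    induction k with
    | zero => simp
    | succ k ih =>
      have hp : 1 ≤ ∏ j ∈ Finset.range (k + 1), (1 + η j) :=
        le_trans (by simp) (Finset.prod_le_prod (s := Finset.range (k + 1)) (f := fun _ => (1 : ℝ))
          (fun _ _ => zero_le_one) fun j _ => by linarith [hη j])
      calc u (k + 1) ≤ (1 + η k) * u k + ε k := h k
        _ ≤ (1 + η k) * ((∏ j ∈ Finset.range k, (1 + η j)) *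
              (u 0 + ∑ j ∈ Finset.range k, ε j)) +
              (∏ j ∈ Finset.range (k + 1), (1 + η j)) * ε k := by
            gcongr
            · linarith [hη k]
            · exact le_mul_of_one_le_left (hε k) hp
        _ = _ := by rw [Finset.prod_range_succ, Finset.sum_range_succ]; ring
  refine ⟨Real.exp (∑' j, η j) * (u 0 + ∑' j, ε j), fun k => (h1 k).trans ?_⟩
  have h2 : ∏ j ∈ Finset.range k, (1 + η j) ≤ Real.exp (∑' j, η j) := by
    refine le_trans (Finset.prod_le_prod (fun j _ => by linarith [hη j])
      (fun j _ => (add_comm 1 (η j)).trans_le (Real.add_one_le_exp (η j)))) ?_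
    rw [← Real.exp_sum]
    exact Real.exp_le_exp.2 (hηs.sum_le_tsum _ fun j _ => hη j)
  have h3 := hεs.sum_le_tsum (Finset.range k) fun j _ => hε j
  have h4 := Finset.sum_nonneg fun j (_ : j ∈ Finset.range k) => hε j
  have := hu 0
  gcongr

theorem exists_tendsto_of_le_add {u s : ℕ → ℝ} (hu : ∀ k, 0 ≤ u k) (hs : Summable s)
    (h : ∀ k, u (k + 1) ≤ u k + s k) : ∃ l, Tendsto u atTop (𝓝 l) := by
  have hS := hs.hasSum.tendsto_sum_nat
  obtain ⟨B, hB⟩ := hS.bddAbove_range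
  have hanti : Antitone fun k => u k - ∑ j ∈ Finset.range k, s j := by
    refine antitone_nat_of_succ_le fun k => ?_
    rw [Finset.sum_range_succ]
    linarith [h k]
  have hbdd : BddBelow (Set.range fun k => u k - ∑ j ∈ Finset.range k, s j) := by
    refine ⟨-B, ?_⟩
    rintro _ ⟨k, rfl⟩
    have : ∑ j ∈ Finset.range k, s j ≤ B := hB ⟨k, rfl⟩
    linarith [hu k]
  have := (tendsto_atTop_ciInf hanti hbdd).add hS
  simp only [sub_add_cancel] at this
  exact ⟨_, this⟩

theorem exists_tendsto_of_le_one_add_mul {u η ε : ℕ → ℝ} (hu : ∀ k, 0 ≤ u k) (hη : ∀ k, 0 ≤ η k)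
    (hε : ∀ k, 0 ≤ ε k) (hηs : Summable η) (hεs : Summable ε)
    (h : ∀ k, u (k + 1) ≤ (1 + η k) * u k + ε k) : ∃ l, Tendsto u atTop (𝓝 l) := by
  obtain ⟨M, hM⟩ := bounded_of_le_one_add_mul hu hη hε hηs hεs h
  refine exists_tendsto_of_le_add hu ((hηs.mul_right M).add hεs) fun k => (h k).trans ?_
  have := mul_le_mul_of_nonneg_left (hM k) (hη k)
  linarith

theorem summable_of_le_sub_add {s θ t : ℕ → ℝ} (hs : ∀ k, 0 ≤ s k) (hθ : ∀ k, 0 ≤ θ k)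
    (ht : Summable t) (h : ∀ k, s (k + 1) ≤ s k - θ k + t k) : Summable θ := by
  obtain ⟨B, hB⟩ := ht.hasSum.tendsto_sum_nat.bddAbove_range
  refine summable_of_sum_range_le (c := s 0 + B) hθ fun n => ?_
  have h1 : ∑ k ∈ Finset.range n, θ k ≤ s 0 - s n + ∑ k ∈ Finset.range n, t k := by
    induction n with
    | zero => simp
    | succ n ih => rw [Finset.sum_range_succ, Finset.sum_range_succ]; linarith [h n]
  have : ∑ j ∈ Finset.range n, t j ≤ B := hB ⟨n, rfl⟩
  linarith [hs n]

/-- A bounded sequence that increases by at most `K (lam k ρ k + e k)` in one step, and for which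
the indices with `ρ k ≥ δ` carry a finite `lam`-mass, vanishes in the limit. -/
theorem tendsto_zero_of_summable_indicator {ρ lam e : ℕ → ℝ} {K R c : ℝ} (hρ : ∀ k, 0 ≤ ρ k)
    (hR : ∀ k, ρ k ≤ R) (hK : 0 ≤ K) (hlam : ∀ k, 0 ≤ lam k) (hlamc : ∀ k, lam k ≤ c)
    (he : ∀ k, 0 ≤ e k) (hes : Summable e)
    (hstep : ∀ k, ρ (k + 1) ≤ ρ k + K * (lam k * ρ k + e k))
    (hind : ∀ δ, 0 < δ → Summable ({k | δ ≤ ρ k}.indicator lam)) (hdiv : ¬ Summable lam) :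
    Tendsto ρ atTop (𝓝 0) := by
  have hc : 0 ≤ c := (hlam 0).trans (hlamc 0)
  have hfreq : ∀ δ, 0 < δ → ∃ᶠ k in atTop, ρ k < δ := by
    intro δ hδ hnot
    refine hdiv ?_
    refine (summable_congr_cofinite ?_).1 (hind δ hδ)
    rw [Nat.cofinite_eq_atTop]
    filter_upwards [hnot] with k hk
    exact Set.indicator_of_mem (s := {k | δ ≤ ρ k}) (not_lt.1 hk) _
  have key : ∀ δ, 0 < δ → ∀ᶠ k in atTop, ρ k < (2 + K * c) * δ := by
    intro δ hδ
    -- From below `δ`, one step reaches at most `A + K * e k`. So `max (ρ k) A` has summable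
    -- increments and converges; as `ρ k < δ` infinitely often, its limit is at most `A`.
    set A := (1 + K * c) * δ with hA
    have hAδ : δ ≤ A := by rw [hA]; nlinarith [mul_nonneg hK hc]
    obtain ⟨l, hl⟩ := exists_tendsto_of_le_add (u := fun k => max (ρ k) A)
      (s := fun k => K * R * {k | δ ≤ ρ k}.indicator lam k + K * e k)
      (fun k => le_max_of_le_left (hρ k)) (((hind δ hδ).mul_left _).add (hes.mul_left _))
      (fun k => by
        have h1 := hstep k
        have h2 := le_max_left (ρ k) A
        have h3 := le_max_right (ρ k) A
        have h4 : 0 ≤ K * e k := mul_nonneg hK (he k)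
        have hR0 : 0 ≤ R := (hρ k).trans (hR k)
        by_cases hk : δ ≤ ρ k
        · rw [Set.indicator_of_mem (s := {k | δ ≤ ρ k}) hk]
          have h5 : K * (lam k * ρ k) ≤ K * (R * lam k) := by
            rw [mul_comm R]
            gcongr
            · exact hlam k
            · exact hR k
          have h6 : 0 ≤ K * (R * lam k) := mul_nonneg hK (mul_nonneg hR0 (hlam k))
          exact max_le (by linarith) (by linarith)
        · rw [Set.indicator_of_notMem (s := {k | δ ≤ ρ k}) hk]
          push Not at hk
          have h5 : K * (lam k * ρ k) ≤ K * (c * δ) := by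
            gcongr
            · exact hρ k
            · exact hlamc k
          have h6 : A = δ + K * (c * δ) := by rw [hA]; ring
          exact max_le (by linarith) (by linarith))
    have hle : l ≤ A := by
      by_contra! hlt
      obtain ⟨k, hk1, hk2⟩ := ((hfreq δ hδ).and_eventually (hl.eventually_const_lt hlt)).exists
      rw [max_eq_right (by linarith)] at hk2
      exact lt_irrefl _ hk2
    have : l < (2 + K * c) * δ := by rw [hA] at hle; linarith
    filter_upwards [hl.eventually_lt_const this] with k hk
    exact lt_of_le_of_lt (le_max_left _ _) hk
  have hKc : 0 < 2 + K * c := by positivity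
  rw [Metric.tendsto_atTop']
  intro ε hε
  obtain ⟨n, hn⟩ := eventually_atTop.1 (key (ε / (2 + K * c)) (by positivity))
  refine ⟨n, fun k hk => ?_⟩
  have := hn k hk.le
  rw [mul_div_cancel₀ _ hKc.ne'] at this
  rwa [Real.dist_eq, sub_zero, abs_of_nonneg (hρ k)]

end VMSFP

/-! ### The slack, the gradient, and a quantitative lower bound for the slack. -/

namespace VMSFP

variable {H : Type*} [NormedAddCommGroup H] [InnerProductSpace ℝ H]

/-- The gap in the inequality `(1 - γ ‖U‖ / (4β)) ‖u‖² ≤ ⟪u, z⟫` for the metric of `U⁻¹`. -/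
def slack (β γ : ℝ) (U : H →L[ℝ] H) (u z : H) : ℝ :=
  ⟪U.inverse u, z⟫ - (1 - γ * ‖U‖ / (4 * β)) * ⟪U.inverse u, u⟫

/-- The four terms are the cocoercivity gap of `b`, a completed square, the gap in `‖u‖² ≤ ‖U‖ ⟪U⁻¹
u, u⟫`, and the variational inequality of the projection. In the setting of the iteration each is
nonnegative. -/
theorem slack_eq {β γ : ℝ} {U : H →L[ℝ] H} {x p xs b : H} (hβ : 0 < β) : slack β γ U (x - p) (x - xs) =
    γ * (⟪b, x - xs⟫ - β * ‖b‖ ^ 2) + γ * β * ‖b - (1 / (2 * β)) • (x - p)‖ ^ 2 +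
      γ / (4 * β) * (‖U‖ * ⟪U.inverse (x - p), x - p⟫ - ‖x - p‖ ^ 2) +
      ⟪U.inverse (x - p) - γ • b, p - xs⟫ := by
  have e : p - xs = (x - xs) - (x - p) := by abel
  rw [slack, e]
  generalize x - p = u
  generalize x - xs = z
  rw [norm_sub_sq_real, norm_smul, mul_pow, inner_sub_left, inner_sub_right, inner_sub_right,
    inner_smul_left, inner_smul_left, inner_smul_right, Real.norm_of_nonneg (by positivity)]
  simp only [RCLike.conj_to_real]
  field_simp
  ring

variable [CompleteSpace H]
variable {G : Type*} [NormedAddCommGroup G] [InnerProductSpace ℝ G] [CompleteSpace G]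

section Gradient

variable {L : H →L[ℝ] G} {C : Set H} {Q : Set G}

theorem mproj_eq_self {Q : Set G} (hne : Q.Nonempty) (hcl : IsClosed Q) (hcv : Convex ℝ Q)
    {z : G} (hz : z ∈ Q) : mproj Q z = z := by
  have h := (mproj_solvesVI hne hcl hcv z).2 z hz
  rw [real_inner_self_nonpos, sub_eq_zero] at h
  exact h.symm

theorem sfpGrad_eq_zero (hne : Q.Nonempty) (hcl : IsClosed Q) (hcv : Convex ℝ Q) {xs : H}
    (hxs : xs ∈ sfpSol L C Q) : sfpGrad L Q xs = 0 := by
  rw [sfpGrad, mproj_eq_self hne hcl hcv hxs.2, sub_self, map_zero]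

/-- The projection inequality in `Q` is tested at `L xs`. With `mul_norm_sfpGrad_sq_le` this gives
cocoercivity relative to a solution; the distance to `Q` is kept on the left because it is needed
for feasibility of the weak limits. -/
theorem norm_sub_mproj_sq_le (hne : Q.Nonempty) (hcl : IsClosed Q) (hcv : Convex ℝ Q) {xs : H}
    (hxs : xs ∈ sfpSol L C Q) (x : H) :
    ‖L x - mproj Q (L x)‖ ^ 2 ≤ ⟪sfpGrad L Q x, x - xs⟫ := by
  have h := (mproj_solvesVI hne hcl hcv (L x)).2 _ hxs.2
  rw [sfpGrad, ContinuousLinearMap.adjoint_inner_left, map_sub]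
  have e : L xs - mproj Q (L x) = (L x - mproj Q (L x)) - (L x - L xs) := by abel
  rw [e, inner_sub_right, real_inner_self_eq_norm_sq] at h
  linarith

theorem mul_norm_sfpGrad_sq_le {β : ℝ} (hβ : 0 < β) (hβL : β * ‖L‖ ^ 2 ≤ 1) (x : H) :
    β * ‖sfpGrad L Q x‖ ^ 2 ≤ ‖L x - mproj Q (L x)‖ ^ 2 := by
  have h : ‖sfpGrad L Q x‖ ≤ ‖L‖ * ‖L x - mproj Q (L x)‖ := by
    have := L.adjoint.le_opNorm (L x - mproj Q (L x))
    rwa [LinearIsometryEquiv.norm_map] at this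
  calc β * ‖sfpGrad L Q x‖ ^ 2 ≤ β * (‖L‖ * ‖L x - mproj Q (L x)‖) ^ 2 := by gcongr
    _ = (β * ‖L‖ ^ 2) * ‖L x - mproj Q (L x)‖ ^ 2 := by ring
    _ ≤ _ := mul_le_of_le_one_left (sq_nonneg _) hβL

theorem norm_sub_mproj_sub_le (hne : Q.Nonempty) (hcl : IsClosed Q) (hcv : Convex ℝ Q) (z w : G) :
    ‖(z - mproj Q z) - (w - mproj Q w)‖ ≤ ‖z - w‖ := by
  have h1 := mproj_solvesVI hne hcl hcv z
  have h2 := mproj_solvesVI hne hcl hcv w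
  have h3 := h1.2 _ h2.1
  have h4 := h2.2 _ h1.1
  set a := z - mproj Q z with ha
  set b := w - mproj Q w with hb
  have e1 : mproj Q w - mproj Q z = (a - b) - (z - w) := by rw [ha, hb]; abel
  have e2 : mproj Q z - mproj Q w = -((a - b) - (z - w)) := by rw [ha, hb]; abel
  rw [e1] at h3
  rw [e2, inner_neg_right] at h4
  have h5 : ⟪a - b, (a - b) - (z - w)⟫ ≤ 0 := by rw [inner_sub_left]; linarith
  rw [inner_sub_right, real_inner_self_eq_norm_sq] at h5
  have h6 := real_inner_le_norm (a - b) (z - w)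
  by_contra! h
  nlinarith [norm_nonneg (z - w)]

theorem norm_sfpGrad_sub_le (hne : Q.Nonempty) (hcl : IsClosed Q) (hcv : Convex ℝ Q) (x y : H) :
    ‖sfpGrad L Q x - sfpGrad L Q y‖ ≤ ‖L‖ ^ 2 * ‖x - y‖ := by
  rw [sfpGrad, sfpGrad, ← map_sub]
  have h1 := L.adjoint.le_opNorm ((L x - mproj Q (L x)) - (L y - mproj Q (L y)))
  rw [LinearIsometryEquiv.norm_map] at h1
  have h2 := norm_sub_mproj_sub_le hne hcl hcv (L x) (L y)
  have h3 := L.le_opNorm (x - y)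
  rw [map_sub] at h3
  calc _ ≤ _ := h1
    _ ≤ ‖L‖ * (‖L‖ * ‖x - y‖) := by gcongr; exact h2.trans h3
    _ = _ := by ring

end Gradient

section Slack

variable {α β γ : ℝ} {U : H →L[ℝ] H} {C : Set H} {x p xs b : H}

theorem SolvesVI.inner_forward_nonneg (hα : 0 < α) (hU : U ∈ PosClass H α)
    (hp : SolvesVI U.inverse C (x - γ • U b) p) (hxs : xs ∈ C) :
    0 ≤ ⟪U.inverse (x - p) - γ • b, p - xs⟫ := by
  have h := hp.2 xs hxs
  have e1 : x - γ • U b - p = (x - p) - γ • U b := by abel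
  have e2 : xs - p = -(p - xs) := by abel
  rw [e1, map_sub, map_smul, PosClass.inverse_apply hα hU, e2, inner_neg_right] at h
  linarith

theorem slack_nonneg (hα : 0 < α) (hβ : 0 < β) (hγ : 0 < γ) (hU : U ∈ PosClass H α)
    (hp : SolvesVI U.inverse C (x - γ • U b) p) (hxs : xs ∈ C)
    (hb : β * ‖b‖ ^ 2 ≤ ⟪b, x - xs⟫) : 0 ≤ slack β γ U (x - p) (x - xs) := by
  rw [slack_eq (b := b) hβ]
  have h1 := PosClass.norm_sq_le_inverse hα hU (x - p)
  have h2 := hp.inner_forward_nonneg hα hU hxs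
  have h3 : 0 ≤ γ * (⟪b, x - xs⟫ - β * ‖b‖ ^ 2) := mul_nonneg hγ.le (by linarith)
  have h4 : 0 ≤ γ / (4 * β) * (‖U‖ * ⟪U.inverse (x - p), x - p⟫ - ‖x - p‖ ^ 2) :=
    mul_nonneg (by positivity) (by linarith)
  positivity

/-- Let `S` be the slack, `u = x - p`, `w = p - xs`. Each of the four terms of `slack_eq` is at most
`S`, so `d = b - u / (2β)` and `T u = ‖U‖ U⁻¹ u - u` are `O(√S)`. Substituting both into the
variational inequality leaves `(1 - γ‖U‖ / (2β)) ⟪u, w⟫ ≥ -O(√S)`, and the margin `ε` keeps the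
coefficient away from zero. The cocoercivity gap, written in `d`, `u`, `w`, contains `‖u‖² / (4β)`,
and everything else in it is now controlled. -/
theorem norm_sq_le_slack {g ε N R : ℝ} (hα : 0 < α) (hβ : 0 < β) (hg : 0 < g) (hε : 0 < ε)
    (hgγ : g ≤ γ) (hγε : γ * ‖U‖ ≤ 2 * β - ε) (hN : 0 < N) (hUN : ‖U‖ ≤ N)
    (hU : U ∈ PosClass H α) (hp : SolvesVI U.inverse C (x - γ • U b) p) (hxs : xs ∈ C)
    (hb : β * ‖b‖ ^ 2 ≤ ⟪b, x - xs⟫) (hR : ‖p - xs‖ ≤ R) :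
    ‖x - p‖ ^ 2 ≤ 4 * β * (2 / g * slack β γ U (x - p) (x - xs) +
      (R * √(1 / (g * β)) + R / ε * (√((N / α + 1) * (4 * β / g)) + 2 * β * √(1 / (g * β)))) *
        √(slack β γ U (x - p) (x - xs))) := by
  have hγ : 0 < γ := hg.trans_le hgγ
  have hS := slack_eq (γ := γ) (U := U) (x := x) (p := p) (xs := xs) (b := b) hβ
  have hS0 := slack_nonneg hα hβ hγ hU hp hxs hb
  have hK := hp.inner_forward_nonneg hα hU hxs
  have hF := PosClass.norm_sq_le_inverse hα hU (x - p)
  set S := slack β γ U (x - p) (x - xs)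
  set A := ⟪b, x - xs⟫ - β * ‖b‖ ^ 2 with hA
  set d := b - (1 / (2 * β)) • (x - p) with hd
  set F := ‖U‖ * ⟪U.inverse (x - p), x - p⟫ - ‖x - p‖ ^ 2 with hFd
  have hA0 : 0 ≤ A := by linarith
  have hF0 : 0 ≤ F := by linarith
  have hR0 : 0 ≤ R := (norm_nonneg _).trans hR
  have t1 : 0 ≤ γ * A := by positivity
  have t2 : 0 ≤ γ * β * ‖d‖ ^ 2 := by positivity
  have t3 : 0 ≤ γ / (4 * β) * F := by positivity
  have hAS : A ≤ 1 / g * S := by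
    rw [div_mul_eq_mul_div, one_mul, le_div_iff₀ hg]
    nlinarith
  have hdS2 : ‖d‖ ^ 2 ≤ 1 / (g * β) * S := by
    rw [div_mul_eq_mul_div, one_mul, le_div_iff₀ (by positivity)]
    have : g * β * ‖d‖ ^ 2 ≤ γ * β * ‖d‖ ^ 2 := by gcongr
    linarith
  have hFS : F ≤ 4 * β / g * S := by
    have : g / (4 * β) * F ≤ γ / (4 * β) * F := by gcongr
    have h2 : F = 4 * β / g * (g / (4 * β) * F) := by field_simp
    rw [h2]
    gcongr
    linarith
  have hdS : ‖d‖ ≤ √(1 / (g * β)) * √S := by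
    rw [← Real.sqrt_mul (by positivity)]
    exact Real.le_sqrt_of_sq_le hdS2
  have hm := PosClass.isMetric_inverse hα hU hN hUN
  set T : H →L[ℝ] H := ‖U‖ • U.inverse - ContinuousLinearMap.id ℝ H with hT
  have hTapp : ∀ v, T v = ‖U‖ • U.inverse v - v := fun v => by simp [hT]
  have hTn : ‖T‖ ≤ N / α + 1 := by
    refine T.opNorm_le_bound (by positivity) fun v => ?_
    rw [hTapp]
    calc _ ≤ ‖‖U‖ • U.inverse v‖ + ‖v‖ := norm_sub_le _ _
      _ ≤ N * (1 / α * ‖v‖) + ‖v‖ := by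
        rw [norm_smul, norm_norm]
        gcongr
        exact hm.norm_apply_le v
      _ = _ := by ring
  have hTs : ‖T (x - p)‖ ^ 2 ≤ ‖T‖ * F := by
    have := norm_sq_apply_le_of_nonneg (T := T)
      (fun v w => by
        rw [hTapp, hTapp, inner_sub_left, inner_sub_right, inner_smul_left, inner_smul_right,
          hm.symm]; rfl)
      (fun v => by
        have := PosClass.norm_sq_le_inverse hα hU v
        rw [hTapp, inner_sub_left, inner_smul_left, real_inner_self_eq_norm_sq]
        simpa using this) (x - p)
    have h2 : ⟪T (x - p), x - p⟫ = F := by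
      rw [hTapp, inner_sub_left, inner_smul_left, real_inner_self_eq_norm_sq]; rfl
    rwa [h2] at this
  have hTS : ‖T (x - p)‖ ≤ √((N / α + 1) * (4 * β / g)) * √S := by
    rw [← Real.sqrt_mul (by positivity)]
    refine Real.le_sqrt_of_sq_le (hTs.trans ?_)
    rw [mul_assoc]
    gcongr
  have eT : ‖U‖ • U.inverse (x - p) = T (x - p) + (x - p) := by rw [hTapp]; abel
  have eb : b = d + (1 / (2 * β)) • (x - p) := by rw [hd]; abel
  have ez : x - xs = (p - xs) + (x - p) := by abel
  generalize hu : x - p = u at *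
  generalize hw : p - xs = w at *
  have hKU : 0 ≤ ⟪T u, w⟫ + (1 - γ * ‖U‖ / (2 * β)) * ⟪u, w⟫ - γ * ‖U‖ * ⟪d, w⟫ := by
    have h1 : 0 ≤ ‖U‖ * ⟪U.inverse u - γ • b, w⟫ := by positivity
    have h2 : ‖U‖ * ⟪U.inverse u - γ • b, w⟫ = ⟪‖U‖ • U.inverse u - (γ * ‖U‖) • b, w⟫ := by
      simp only [inner_sub_left, inner_smul_left, RCLike.conj_to_real]; ring
    rw [h2, eT, eb] at h1
    simp only [inner_sub_left, inner_add_left, inner_smul_left, smul_add,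
      RCLike.conj_to_real] at h1
    refine h1.trans_eq ?_
    field_simp
    ring
  have hTw : ⟪T u, w⟫ ≤ ‖T u‖ * R := (real_inner_le_norm _ _).trans (by gcongr)
  have hdw : -⟪d, w⟫ ≤ ‖d‖ * R := by
    have := neg_le_of_abs_le (abs_real_inner_le_norm d w)
    have h2 : ‖d‖ * ‖w‖ ≤ ‖d‖ * R := by gcongr
    linarith
  have hdw2 : γ * ‖U‖ * -⟪d, w⟫ ≤ 2 * β * (‖d‖ * R) := by
    have hν : 0 ≤ γ * ‖U‖ := by positivity
    have hν2 : γ * ‖U‖ ≤ 2 * β := by linarith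
    calc γ * ‖U‖ * -⟪d, w⟫ ≤ γ * ‖U‖ * (‖d‖ * R) := by gcongr
      _ ≤ _ := by gcongr
  have huw : -(2 * β / ε * ((‖T u‖ + 2 * β * ‖d‖) * R)) ≤ ⟪u, w⟫ := by
    by_contra! hlt
    have hY : 0 ≤ (‖T u‖ + 2 * β * ‖d‖) * R := by positivity
    have hYY : 0 ≤ 2 * β / ε * ((‖T u‖ + 2 * β * ‖d‖) * R) := by positivity
    have hc : ε / (2 * β) ≤ 1 - γ * ‖U‖ / (2 * β) := by
      rw [le_sub_iff_add_le, ← add_div, div_le_one (by positivity)]; linarith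
    have h1 : (1 - γ * ‖U‖ / (2 * β)) * ⟪u, w⟫ ≤ ε / (2 * β) * ⟪u, w⟫ :=
      mul_le_mul_of_nonpos_right hc (by linarith)
    have h2 : ε / (2 * β) * ⟪u, w⟫ <
        ε / (2 * β) * -(2 * β / ε * ((‖T u‖ + 2 * β * ‖d‖) * R)) := by gcongr
    have h3 : ε / (2 * β) * -(2 * β / ε * ((‖T u‖ + 2 * β * ‖d‖) * R)) =
        -((‖T u‖ + 2 * β * ‖d‖) * R) := by field_simp
    linarith
  have hAe : A = ⟪d, w⟫ - β * ‖d‖ ^ 2 + 1 / (2 * β) * ⟪u, w⟫ + 1 / (4 * β) * ‖u‖ ^ 2 := by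
    rw [hA, ez, eb, norm_add_sq_real, norm_smul, mul_pow, Real.norm_of_nonneg (by positivity)]
    simp only [inner_add_left, inner_add_right, inner_smul_left, inner_smul_right,
      RCLike.conj_to_real, real_inner_self_eq_norm_sq]
    field_simp
    ring
  have huw2 : -(1 / ε * ((‖T u‖ + 2 * β * ‖d‖) * R)) ≤ 1 / (2 * β) * ⟪u, w⟫ := by
    have := mul_le_mul_of_nonneg_left huw (by positivity : 0 ≤ 1 / (2 * β))
    refine le_trans (le_of_eq ?_) this
    field_simp
  have hβd : β * ‖d‖ ^ 2 ≤ 1 / g * S := by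
    calc β * ‖d‖ ^ 2 ≤ β * (1 / (g * β) * S) := by gcongr
      _ = _ := by field_simp
  have hmain : 1 / (4 * β) * ‖u‖ ^ 2 ≤ 2 / g * S + R * ‖d‖ +
      R / ε * (‖T u‖ + 2 * β * ‖d‖) := by
    have e1 : 2 / g * S = 1 / g * S + 1 / g * S := by ring
    have e2 : R / ε * (‖T u‖ + 2 * β * ‖d‖) = 1 / ε * ((‖T u‖ + 2 * β * ‖d‖) * R) := by ring
    rw [e1, e2]
    linarith
  have e3 : ‖u‖ ^ 2 = 4 * β * (1 / (4 * β) * ‖u‖ ^ 2) := by field_simp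
  rw [e3]
  gcongr
  refine hmain.trans ?_
  calc 2 / g * S + R * ‖d‖ + R / ε * (‖T u‖ + 2 * β * ‖d‖)
      ≤ 2 / g * S + R * (√(1 / (g * β)) * √S) +
        R / ε * (√((N / α + 1) * (4 * β / g)) * √S + 2 * β * (√(1 / (g * β)) * √S)) := by gcongr
    _ = _ := by ring

/-- Uniformly in the metric and in the step size, a residual bounded below forces a slack
bounded below. -/
theorem exists_le_slack {g ε N R : ℝ} (hα : 0 < α) (hβ : 0 < β) (hg : 0 < g) (hε : 0 < ε)
    (hN : 0 < N) {δ : ℝ} (hδ : 0 < δ) :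
    ∃ σ > 0, ∀ (U : H →L[ℝ] H) (γ : ℝ) (x p xs b : H), g ≤ γ → γ * ‖U‖ ≤ 2 * β - ε → ‖U‖ ≤ N →
      U ∈ PosClass H α → SolvesVI U.inverse C (x - γ • U b) p → xs ∈ C →
      β * ‖b‖ ^ 2 ≤ ⟪b, x - xs⟫ → ‖p - xs‖ ≤ R → δ ≤ ‖x - p‖ →
      σ ≤ slack β γ U (x - p) (x - xs) := by
  set c₁ := 4 * β * (2 / g)
  set c₂ := 4 * β * (R * √(1 / (g * β)) +
    R / ε * (√((N / α + 1) * (4 * β / g)) + 2 * β * √(1 / (g * β))))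
  -- Below this threshold `S ≤ √S`, so the linear and the root term of the bound combine.
  set t := min 1 (δ ^ 2 / (c₁ + |c₂| + 1)) with ht
  have hc₁ : 0 ≤ c₁ := by positivity
  have htp : 0 < t := lt_min one_pos (by positivity)
  refine ⟨t ^ 2, by positivity, fun U γ x p xs b hgγ hγε hUN hU hp hxs hb hR hδx => ?_⟩
  have h := norm_sq_le_slack hα hβ hg hε hgγ hγε hN hUN hU hp hxs hb hR
  have hS0 := slack_nonneg hα hβ (hg.trans_le hgγ) hU hp hxs hb
  set S := slack β γ U (x - p) (x - xs)
  by_contra! hlt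
  have h1 : √S < t := (Real.sqrt_lt' htp).2 hlt
  have h0 := Real.sqrt_nonneg S
  have h2 : S ≤ √S := by
    have := Real.mul_self_sqrt hS0
    have : √S ≤ 1 := h1.le.trans (min_le_left _ _)
    nlinarith
  have h3 : δ ^ 2 ≤ (c₁ + |c₂| + 1) * √S := by
    calc δ ^ 2 ≤ ‖x - p‖ ^ 2 := by gcongr
      _ ≤ c₁ * S + c₂ * √S := h.trans_eq (by ring)
      _ ≤ c₁ * √S + |c₂| * √S := by gcongr; exact le_abs_self _
      _ ≤ _ := by linarith
  have h4 : (c₁ + |c₂| + 1) * √S < (c₁ + |c₂| + 1) * (δ ^ 2 / (c₁ + |c₂| + 1)) := by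
    have := h1.trans_le (min_le_right _ _)
    gcongr
  rw [mul_div_cancel₀ _ (by positivity)] at h4
  linarith

/-- The square is expanded, using `1 / avgConst = 2 (1 - γ‖U‖ / (4β))`. The slack is kept as an
equality term, since it is the only useful decrease when `lam` approaches `1 / avgConst`. -/
theorem wnorm_relaxed_step_sq (hα : 0 < α) (hβ : 0 < β) (hU : U ∈ PosClass H α)
    (lam : ℝ) (u z : H) :
    wnorm U.inverse (z - lam • u) ^ 2 = wnorm U.inverse z ^ 2 -
      lam * (1 / avgConst β γ U - lam) * wnorm U.inverse u ^ 2 - 2 * lam * slack β γ U u z := by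
  have hm := PosClass.isMetric_inverse hα hU (N := ‖U‖ + 1) (by positivity) (by linarith)
  rw [hm.wnorm_sq, hm.wnorm_sq, hm.wnorm_sq, hm.inner_sub_self, map_smul, inner_smul_left,
    inner_smul_right, inner_smul_right, hm.inner_comm u z, slack, avgConst, one_div_div]
  simp only [RCLike.conj_to_real]
  field_simp
  ring

end Slack

end VMSFP

/-! ### The iteration: quasi-Fejér monotonicity and summable decrease. -/

namespace VMSFP

variable {H : Type*} [NormedAddCommGroup H] [InnerProductSpace ℝ H] [CompleteSpace H]
variable {G : Type*} [NormedAddCommGroup G] [InnerProductSpace ℝ G] [CompleteSpace G]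

/-- The relaxed variable metric iteration with errors, together with its standing assumptions. -/
structure IsIteration (L : H →L[ℝ] G) (C : Set H) (Q : Set G) (β α N : ℝ) (η : ℕ → ℝ)
    (U : ℕ → H →L[ℝ] H) (γ lam : ℕ → ℝ) (a b x : ℕ → H) : Prop where
  C_ne : C.Nonempty
  C_closed : IsClosed C
  C_convex : Convex ℝ C
  Q_ne : Q.Nonempty
  Q_closed : IsClosed Q
  Q_convex : Convex ℝ Q
  β_pos : 0 < β
  β_le : β * ‖L‖ ^ 2 ≤ 1
  α_pos : 0 < α
  N_pos : 0 < N
  η_nonneg : ∀ k, 0 ≤ η k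
  η_summable : Summable η
  mem : ∀ k, U k ∈ PosClass H α
  norm_le : ∀ k, ‖U k‖ ≤ N
  mono : ∀ k, U k ≤ (1 + η k) • U (k + 1)
  γ_pos : ∀ k, 0 < γ k
  γ_lt : ∀ k, γ k * ‖U k‖ < 2 * β
  lam_pos : ∀ k, 0 < lam k
  lam_lt : ∀ k, lam k < 1 / avgConst β (γ k) (U k)
  a_summable : Summable fun k => lam k * ‖a k‖
  b_summable : Summable fun k => lam k * ‖b k‖
  step : ∀ k, x (k + 1) = x k + lam k •
    (wproj (U k).inverse C (x k - γ k • U k (sfpGrad L Q (x k) + b k)) + a k - x k)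

/-- The forward-backward point `P_C^{U⁻¹}(x - γ U B x)`. -/
def fwdBwd (L : H →L[ℝ] G) (C : Set H) (Q : Set G) (U : H →L[ℝ] H) (γ : ℝ) (x : H) : H :=
  wproj U.inverse C (x - γ • U (sfpGrad L Q x))

namespace IsIteration

variable {L : H →L[ℝ] G} {C : Set H} {Q : Set G} {β α N : ℝ} {η : ℕ → ℝ}
  {U : ℕ → H →L[ℝ] H} {γ lam : ℕ → ℝ} {a b x : ℕ → H}

theorem isMetric (I : IsIteration L C Q β α N η U γ lam a b x) (k : ℕ) :
    IsMetric (U k).inverse (1 / N) (1 / α) :=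
  PosClass.isMetric_inverse I.α_pos (I.mem k) I.N_pos (I.norm_le k)

theorem fwdBwd_solvesVI (I : IsIteration L C Q β α N η U γ lam a b x) (k : ℕ) :
    SolvesVI (U k).inverse C (x k - γ k • U k (sfpGrad L Q (x k)))
      (fwdBwd L C Q (U k) (γ k) (x k)) :=
  wproj_solvesVI (I.isMetric k) I.C_ne I.C_closed I.C_convex _

theorem cocoercive (I : IsIteration L C Q β α N η U γ lam a b x) {xs : H}
    (hxs : xs ∈ sfpSol L C Q) (v : H) :
    β * ‖sfpGrad L Q v‖ ^ 2 ≤ ⟪sfpGrad L Q v, v - xs⟫ :=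
  (mul_norm_sfpGrad_sq_le I.β_pos I.β_le v).trans
    (norm_sub_mproj_sq_le I.Q_ne I.Q_closed I.Q_convex hxs v)

theorem slack_nonneg (I : IsIteration L C Q β α N η U γ lam a b x) {xs : H}
    (hxs : xs ∈ sfpSol L C Q) (k : ℕ) :
    0 ≤ slack β (γ k) (U k) (x k - fwdBwd L C Q (U k) (γ k) (x k)) (x k - xs) :=
  VMSFP.slack_nonneg I.α_pos I.β_pos (I.γ_pos k) (I.mem k) (I.fwdBwd_solvesVI k) hxs.1
    (I.cocoercive hxs _)

theorem exists_error (I : IsIteration L C Q β α N η U γ lam a b x) :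
    ∃ e : ℕ → H, (Summable fun k => lam k * ‖e k‖) ∧ ∀ k, x (k + 1) =
      x k - lam k • (x k - fwdBwd L C Q (U k) (γ k) (x k)) + lam k • e k := by
  refine ⟨fun k => wproj (U k).inverse C (x k - γ k • U k (sfpGrad L Q (x k) + b k)) -
    fwdBwd L C Q (U k) (γ k) (x k) + a k, ?_, fun k => ?_⟩
  · refine Summable.of_nonneg_of_le (fun k => mul_nonneg (I.lam_pos k).le (norm_nonneg _))
      (fun k => ?_) ((I.b_summable.mul_left (1 / α / (1 / N) * (2 * β))).add I.a_summable)
    have h := SolvesVI.dist_le (I.isMetric k) (wproj_solvesVI (I.isMetric k) I.C_ne I.C_closed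
      I.C_convex (x k - γ k • U k (sfpGrad L Q (x k) + b k))) (I.fwdBwd_solvesVI k)
    have e1 : x k - γ k • U k (sfpGrad L Q (x k) + b k) -
        (x k - γ k • U k (sfpGrad L Q (x k))) = -(γ k • U k (b k)) := by
      rw [map_add, smul_add]; abel
    rw [e1, norm_neg, norm_smul, Real.norm_of_nonneg (I.γ_pos k).le] at h
    have h2 : γ k * ‖U k (b k)‖ ≤ 2 * β * ‖b k‖ := by
      calc _ ≤ γ k * (‖U k‖ * ‖b k‖) := by
            have := (I.γ_pos k).le
            gcongr
            exact (U k).le_opNorm _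
        _ = γ k * ‖U k‖ * ‖b k‖ := by ring
        _ ≤ _ := mul_le_mul_of_nonneg_right (I.γ_lt k).le (norm_nonneg _)
    have hl := (I.lam_pos k).le
    have hα := I.α_pos
    have hN := I.N_pos
    calc _ ≤ lam k * (1 / α / (1 / N) * (2 * β * ‖b k‖) + ‖a k‖) := by
          gcongr
          refine (norm_add_le _ _).trans ?_
          gcongr
          refine h.trans ?_
          gcongr
      _ = _ := by ring
  · rw [I.step, ← sub_eq_zero]
    simp only [smul_sub, smul_add]
    abel

theorem avgConst_inv_bounds (I : IsIteration L C Q β α N η U γ lam a b x) (k : ℕ) :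
    1 / avgConst β (γ k) (U k) ≤ 2 := by
  have hβ := I.β_pos
  rw [avgConst, one_div_div, div_le_iff₀ (by positivity)]
  have : 0 ≤ γ k * ‖U k‖ := mul_nonneg (I.γ_pos k).le (norm_nonneg _)
  linarith

theorem lam_le_two (I : IsIteration L C Q β α N η U γ lam a b x) (k : ℕ) : lam k ≤ 2 :=
  (I.lam_lt k).le.trans (I.avgConst_inv_bounds k)

theorem wnorm_succ_sq_le (I : IsIteration L C Q β α N η U γ lam a b x) (k : ℕ) (v : H) :
    wnorm (U (k + 1)).inverse v ^ 2 ≤ (1 + η k) * wnorm (U k).inverse v ^ 2 := by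
  rw [(I.isMetric _).wnorm_sq, (I.isMetric _).wnorm_sq]
  exact PosClass.inverse_le_of_le I.α_pos (I.mem k) (I.mem (k + 1)) (I.mono k) v

theorem wnorm_succ_le (I : IsIteration L C Q β α N η U γ lam a b x) (k : ℕ) (v : H) :
    wnorm (U (k + 1)).inverse v ≤ (1 + η k) * wnorm (U k).inverse v := by
  have hη := I.η_nonneg k
  refine le_of_sq_le_sq ?_ (mul_nonneg (by linarith) (IsMetric.wnorm_nonneg _ _))
  refine (I.wnorm_succ_sq_le k v).trans ?_
  rw [mul_pow]
  gcongr
  nlinarith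

theorem wnorm_relaxed_step_sq (I : IsIteration L C Q β α N η U γ lam a b x) (k : ℕ) (u z : H) :
    wnorm (U k).inverse (z - lam k • u) ^ 2 = wnorm (U k).inverse z ^ 2 -
      lam k * (1 / avgConst β (γ k) (U k) - lam k) * wnorm (U k).inverse u ^ 2 -
      2 * lam k * slack β (γ k) (U k) u z :=
  VMSFP.wnorm_relaxed_step_sq I.α_pos I.β_pos (I.mem k) _ _ _

theorem relax_nonneg (I : IsIteration L C Q β α N η U γ lam a b x) (k : ℕ) :
    0 ≤ lam k * (1 / avgConst β (γ k) (U k) - lam k) :=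
  mul_nonneg (I.lam_pos k).le (by linarith [I.lam_lt k])

theorem wnorm_relaxed_step_le (I : IsIteration L C Q β α N η U γ lam a b x) {xs : H}
    (hxs : xs ∈ sfpSol L C Q) (k : ℕ) :
    wnorm (U k).inverse (x k - xs - lam k • (x k - fwdBwd L C Q (U k) (γ k) (x k))) ≤
      wnorm (U k).inverse (x k - xs) := by
  refine le_of_sq_le_sq ?_ (IsMetric.wnorm_nonneg _ _)
  rw [I.wnorm_relaxed_step_sq]
  have h1 := mul_nonneg (I.relax_nonneg k)
    (sq_nonneg (wnorm (U k).inverse (x k - fwdBwd L C Q (U k) (γ k) (x k))))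
  have h2 := mul_nonneg (I.lam_pos k).le (I.slack_nonneg hxs k)
  linarith

theorem wnorm_step_le (I : IsIteration L C Q β α N η U γ lam a b x) {e : ℕ → H}
    (he : ∀ k, x (k + 1) = x k - lam k • (x k - fwdBwd L C Q (U k) (γ k) (x k)) + lam k • e k)
    (xs : H) (k : ℕ) :
    wnorm (U k).inverse (x (k + 1) - xs) ≤
      wnorm (U k).inverse (x k - xs - lam k • (x k - fwdBwd L C Q (U k) (γ k) (x k))) +
        √(1 / α) * (lam k * ‖e k‖) := by
  have e1 : x (k + 1) - xs = (x k - xs - lam k • (x k - fwdBwd L C Q (U k) (γ k) (x k))) +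
      lam k • e k := by rw [he]; abel
  rw [e1]
  refine ((I.isMetric k).wnorm_add_le _ _).trans ?_
  gcongr
  refine ((I.isMetric k).wnorm_le _).trans_eq ?_
  rw [norm_smul, Real.norm_of_nonneg (I.lam_pos k).le]

theorem η_le (I : IsIteration L C Q β α N η U γ lam a b x) (k : ℕ) : η k ≤ ∑' j, η j :=
  I.η_summable.le_tsum k fun j _ => I.η_nonneg j

theorem quasi_fejer (I : IsIteration L C Q β α N η U γ lam a b x) {xs : H}
    (hxs : xs ∈ sfpSol L C Q) : ∃ ε : ℕ → ℝ, (∀ k, 0 ≤ ε k) ∧ Summable ε ∧ ∀ k,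
      wnorm (U (k + 1)).inverse (x (k + 1) - xs) ≤
        (1 + η k) * wnorm (U k).inverse (x k - xs) + ε k := by
  obtain ⟨e, hes, he⟩ := I.exists_error
  have hε : ∀ k, 0 ≤ √(1 / α) * (lam k * ‖e k‖) := fun k =>
    mul_nonneg (Real.sqrt_nonneg _) (mul_nonneg (I.lam_pos k).le (norm_nonneg _))
  have hs : 0 ≤ ∑' j, η j := tsum_nonneg I.η_nonneg
  refine ⟨fun k => (1 + ∑' j, η j) * (√(1 / α) * (lam k * ‖e k‖)),
    fun k => mul_nonneg (by linarith) (hε k), (hes.mul_left _).mul_left _, fun k => ?_⟩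
  have h1 := I.wnorm_step_le he xs k
  have h2 := I.wnorm_relaxed_step_le hxs k
  have h3 := I.η_nonneg k
  have h4 := I.η_le k
  have h5 := hε k
  calc _ ≤ (1 + η k) * wnorm (U k).inverse (x (k + 1) - xs) := I.wnorm_succ_le k _
    _ ≤ (1 + η k) * (wnorm (U k).inverse (x k - xs) + √(1 / α) * (lam k * ‖e k‖)) := by
      gcongr; linarith
    _ ≤ _ := by
      rw [mul_add]
      exact add_le_add_right (mul_le_mul_of_nonneg_right (by linarith) h5) _

theorem exists_tendsto_wnorm (I : IsIteration L C Q β α N η U γ lam a b x) {xs : H}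
    (hxs : xs ∈ sfpSol L C Q) :
    ∃ l, Tendsto (fun k => wnorm (U k).inverse (x k - xs)) atTop (𝓝 l) := by
  obtain ⟨ε, h0, hs, h⟩ := I.quasi_fejer hxs
  exact exists_tendsto_of_le_one_add_mul (fun k => IsMetric.wnorm_nonneg _ _) I.η_nonneg h0
    I.η_summable hs h

theorem exists_wnorm_le (I : IsIteration L C Q β α N η U γ lam a b x) {xs : H}
    (hxs : xs ∈ sfpSol L C Q) : ∃ V, ∀ k, wnorm (U k).inverse (x k - xs) ≤ V := by
  obtain ⟨ε, h0, hs, h⟩ := I.quasi_fejer hxs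
  exact bounded_of_le_one_add_mul (fun k => IsMetric.wnorm_nonneg _ _) I.η_nonneg h0
    I.η_summable hs h

theorem summable_decrease (I : IsIteration L C Q β α N η U γ lam a b x) {xs : H}
    (hxs : xs ∈ sfpSol L C Q) :
    Summable fun k => lam k * (1 / avgConst β (γ k) (U k) - lam k) *
        wnorm (U k).inverse (x k - fwdBwd L C Q (U k) (γ k) (x k)) ^ 2 +
      2 * lam k * slack β (γ k) (U k) (x k - fwdBwd L C Q (U k) (γ k) (x k)) (x k - xs) := by
  obtain ⟨e, hes, he⟩ := I.exists_error
  obtain ⟨V, hV⟩ := I.exists_wnorm_le hxs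
  set ε : ℕ → ℝ := fun k => √(1 / α) * (lam k * ‖e k‖) with hεd
  have hε : ∀ k, 0 ≤ ε k := fun k =>
    mul_nonneg (Real.sqrt_nonneg _) (mul_nonneg (I.lam_pos k).le (norm_nonneg _))
  have hεs : Summable ε := hes.mul_left _
  set E := ∑' j, ε j
  have hE : ∀ k, ε k ≤ E := fun k => hεs.le_tsum k fun j _ => hε j
  set S := ∑' j, η j
  have hS : ∀ k, η k ≤ S := I.η_le
  refine summable_of_le_sub_add (s := fun k => wnorm (U k).inverse (x k - xs) ^ 2)
    (t := fun k => V ^ 2 * η k + (1 + S) * (2 * V + E) * ε k) (fun k => sq_nonneg _)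
    (fun k => ?_) ((I.η_summable.mul_left _).add (hεs.mul_left _)) (fun k => ?_)
  · have h1 := mul_nonneg (I.relax_nonneg k)
      (sq_nonneg (wnorm (U k).inverse (x k - fwdBwd L C Q (U k) (γ k) (x k))))
    have h2 := mul_nonneg (I.lam_pos k).le (I.slack_nonneg hxs k)
    linarith
  · have h1 := I.wnorm_step_le he xs k
    have h2 := I.wnorm_relaxed_step_le hxs k
    have h3 := I.wnorm_relaxed_step_sq k (x k - fwdBwd L C Q (U k) (γ k) (x k)) (x k - xs)
    have h4 := I.wnorm_succ_sq_le k (x (k + 1) - xs)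
    have hw := IsMetric.wnorm_nonneg (U k).inverse (x k - xs)
    have hw2 := IsMetric.wnorm_nonneg (U k).inverse (x (k + 1) - xs)
    have hz := IsMetric.wnorm_nonneg (U k).inverse
      (x k - xs - lam k • (x k - fwdBwd L C Q (U k) (γ k) (x k)))
    have hVk := hV k
    have hη := I.η_nonneg k
    generalize wnorm (U k).inverse
      (x k - xs - lam k • (x k - fwdBwd L C Q (U k) (γ k) (x k))) = Z at *
    generalize hw' : wnorm (U k).inverse (x k - xs) = w at *
    generalize wnorm (U k).inverse (x (k + 1) - xs) = w' at *
    have h6 : w' ^ 2 ≤ Z ^ 2 + (2 * V + E) * ε k := by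
      have : w' ^ 2 ≤ (Z + ε k) ^ 2 := pow_le_pow_left₀ hw2 h1 2
      nlinarith [hE k, hε k]
    have h7 : Z ^ 2 ≤ V ^ 2 := pow_le_pow_left₀ hz (h2.trans hVk) 2
    have h8 : 0 ≤ (2 * V + E) * ε k :=
      mul_nonneg (by linarith [hE k, hε k]) (hε k)
    have h9 : (1 + η k) * w' ^ 2 ≤
        Z ^ 2 + V ^ 2 * η k + (1 + S) * ((2 * V + E) * ε k) := by
      calc (1 + η k) * w' ^ 2 ≤ (1 + η k) * (Z ^ 2 + (2 * V + E) * ε k) := by gcongr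
        _ = Z ^ 2 + Z ^ 2 * η k + (1 + η k) * ((2 * V + E) * ε k) := by ring
        _ ≤ _ := by gcongr; exact hS k
    linarith

theorem exists_norm_le (I : IsIteration L C Q β α N η U γ lam a b x) {xs : H}
    (hxs : xs ∈ sfpSol L C Q) : ∃ R, ∀ k, ‖x k - xs‖ ≤ R ∧
      ‖fwdBwd L C Q (U k) (γ k) (x k) - xs‖ ≤ R := by
  obtain ⟨V, hV⟩ := I.exists_wnorm_le hxs
  have hN := I.N_pos
  have hβ := I.β_pos
  have hV0 : 0 ≤ V := (IsMetric.wnorm_nonneg _ _).trans (hV 0)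
  have hs : 0 < √(1 / N) := by positivity
  have key : ∀ k (v : H) (t : ℝ), wnorm (U k).inverse v ≤ t → ‖v‖ ≤ t / √(1 / N) := by
    intro k v t h
    rw [le_div_iff₀ hs, mul_comm]
    exact ((I.isMetric k).le_wnorm v).trans h
  -- The factor is `1 + 2`: nonnegative slack and `1 - γ‖U‖ / (4β) ≥ 1/2` give `‖u‖ ≤ 2 V` in the
  -- metric.
  refine ⟨3 * V / √(1 / N), fun k => ⟨key k _ _ ((hV k).trans (by linarith)), key k _ _ ?_⟩⟩
  set u := x k - fwdBwd L C Q (U k) (γ k) (x k) with hu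
  have h1 : 0 ≤ slack β (γ k) (U k) u (x k - xs) := I.slack_nonneg hxs k
  have h2 := (I.isMetric k).inner_le_wnorm u (x k - xs)
  have h3 : wnorm (U k).inverse u ≤ 2 * V := by
    rw [slack, ← (I.isMetric k).wnorm_sq] at h1
    have h4 : 1 / 2 ≤ 1 - γ k * ‖U k‖ / (4 * β) := by
      have : γ k * ‖U k‖ / (4 * β) ≤ 1 / 2 := by
        rw [div_le_iff₀ (by positivity)]; linarith [I.γ_lt k]
      linarith
    have h5 := IsMetric.wnorm_nonneg (U k).inverse u
    have h6 : 1 / 2 * wnorm (U k).inverse u ^ 2 ≤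
        (1 - γ k * ‖U k‖ / (4 * β)) * wnorm (U k).inverse u ^ 2 := by gcongr
    have h7 : wnorm (U k).inverse u * wnorm (U k).inverse (x k - xs) ≤
        wnorm (U k).inverse u * V := by gcongr; exact hV k
    by_contra! hlt
    nlinarith
  have e1 : fwdBwd L C Q (U k) (γ k) (x k) - xs = (x k - xs) + (-1 : ℝ) • u := by
    rw [hu, neg_one_smul]; abel
  have e2 : wnorm (U k).inverse ((-1 : ℝ) • u) = wnorm (U k).inverse u := by
    simp [wnorm]
  rw [e1]
  refine ((I.isMetric k).wnorm_add_le _ _).trans ?_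
  rw [e2]
  linarith [hV k]

theorem tendsto_residual_of_le (I : IsIteration L C Q β α N η U γ lam a b x)
    (hΩ : (sfpSol L C Q).Nonempty) {lamLow τ : ℝ} (hl : 0 < lamLow) (hτ : 0 < τ)
    (h : ∀ k, lamLow ≤ lam k ∧ lam k ≤ 1 / avgConst β (γ k) (U k) - τ) :
    Tendsto (fun k => residual L C Q (U k) (γ k) (x k)) atTop (𝓝 0) := by
  obtain ⟨xs, hxs⟩ := hΩ
  have hN := I.N_pos
  have h0 := (I.summable_decrease hxs).tendsto_atTop_zero
  have h1 : Tendsto (fun k => ‖x k - fwdBwd L C Q (U k) (γ k) (x k)‖ ^ 2) atTop (𝓝 0) := by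
    have h2 := h0.const_mul (N / (lamLow * τ))
    rw [mul_zero] at h2
    refine squeeze_zero (fun k => sq_nonneg _) (fun k => ?_) h2
    have h3 := (I.isMetric k).lower (x k - fwdBwd L C Q (U k) (γ k) (x k))
    have h4 := mul_nonneg (I.lam_pos k).le (I.slack_nonneg hxs k)
    rw [← (I.isMetric k).wnorm_sq] at h3
    have h5 : lamLow * τ ≤ lam k * (1 / avgConst β (γ k) (U k) - lam k) := by
      have := (I.lam_pos k).le
      have := (h k).2
      gcongr
      · exact (h k).1
      · linarith
    set D := wnorm (U k).inverse (x k - fwdBwd L C Q (U k) (γ k) (x k)) ^ 2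
    have hD : 0 ≤ D := sq_nonneg _
    rw [div_mul_eq_mul_div, one_mul, div_le_iff₀ hN] at h3
    have h6 : lamLow * τ * D ≤ lam k * (1 / avgConst β (γ k) (U k) - lam k) * D := by gcongr
    rw [div_mul_eq_mul_div, le_div_iff₀ (by positivity)]
    calc _ ≤ D * N * (lamLow * τ) := by gcongr
      _ = N * (lamLow * τ * D) := by ring
      _ ≤ _ := by gcongr; linarith
  have h2 := h1.sqrt
  simp only [Real.sqrt_sq (norm_nonneg _), Real.sqrt_zero] at h2
  exact h2

end IsIteration

end VMSFP

/-! ### Weak limits, strong convergence of the inverse metrics, and weak convergence of the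
iterates. -/

namespace VMSFP

variable {H : Type*} [NormedAddCommGroup H] [InnerProductSpace ℝ H]

theorem tendsto_inner_of_sub_tendsto_zero {ι : Type*} {l : Filter ι} {x p : ι → H} {w : H}
    (h : ∀ v, Tendsto (fun k => ⟪x k, v⟫) l (𝓝 ⟪w, v⟫))
    (hxp : Tendsto (fun k => ‖x k - p k‖) l (𝓝 0)) (v : H) :
    Tendsto (fun k => ⟪p k, v⟫) l (𝓝 ⟪w, v⟫) := by
  have h1 : Tendsto (fun k => ⟪x k - p k, v⟫) l (𝓝 0) := by
    refine squeeze_zero_norm (fun k => ?_) (by simpa using hxp.mul_const ‖v‖)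
    exact norm_inner_le_norm _ _
  have h2 := (h v).sub h1
  simp only [inner_sub_left, sub_sub_cancel, sub_zero] at h2
  exact h2

variable [CompleteSpace H]
variable {G : Type*} [NormedAddCommGroup G] [InnerProductSpace ℝ G] [CompleteSpace G]

/-- Banach–Alaoglu through the Riesz isometry; ultrafilters take the place of subsequences. -/
theorem exists_weak_limit {x : ℕ → H} {R : ℝ} (hx : ∀ k, ‖x k‖ ≤ R) (f : Ultrafilter ℕ) :
    ∃ w, ∀ v, Tendsto (fun k => ⟪x k, v⟫) f (𝓝 ⟪w, v⟫) := by
  let F : ℕ → WeakDual ℝ H := fun k =>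
    StrongDual.toWeakDual (InnerProductSpace.toDual ℝ H (x k))
  have hc := WeakDual.isCompact_closedBall (𝕜 := ℝ) (E := H) 0 R
  have hmem : ∀ k, F k ∈ WeakDual.toStrongDual ⁻¹' Metric.closedBall (0 : StrongDual ℝ H) R := by
    intro k
    rw [Set.mem_preimage, mem_closedBall_zero_iff]
    exact (LinearIsometryEquiv.norm_map (InnerProductSpace.toDual ℝ H) (x k)).trans_le (hx k)
  obtain ⟨φ, -, hφ⟩ := hc.ultrafilter_le_nhds (f.map F)
    (le_principal_iff.2 (Filter.mem_map.2 (Filter.univ_mem' hmem)))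
  have hφ' : Tendsto F f (𝓝 φ) := hφ
  refine ⟨(InnerProductSpace.toDual ℝ H).symm (WeakDual.toStrongDual φ), fun v => ?_⟩
  have := ((WeakDual.eval_continuous v).tendsto φ).comp hφ'
  rw [InnerProductSpace.toDual_symm_apply]
  exact this

theorem tendsto_toWeakSpace_of_forall_inner {ι : Type*} {l : Filter ι} {x : ι → H} {w : H}
    (h : ∀ v, Tendsto (fun k => ⟪x k, v⟫) l (𝓝 ⟪w, v⟫)) :
    Tendsto (fun k => toWeakSpace ℝ H (x k)) l (𝓝 (toWeakSpace ℝ H w)) := by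
  have hinj : Function.Injective (topDualPairing ℝ H).flip := by
    intro v w hvw
    refine ext_inner_left ℝ fun u => ?_
    exact LinearMap.congr_fun hvw (InnerProductSpace.toDual ℝ H u)
  refine (WeakBilin.tendsto_iff_forall_eval_tendsto _ hinj).2 fun φ => ?_
  have := h ((InnerProductSpace.toDual ℝ H).symm φ)
  have e : ∀ v : H, φ v = ⟪v, (InnerProductSpace.toDual ℝ H).symm φ⟫ := fun v => by
    rw [real_inner_comm, InnerProductSpace.toDual_symm_apply]
  simp_rw [← e] at this
  exact this

/-- A closed convex set contains the weak limits of its sequences. -/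
theorem mem_of_weak_limit {ι : Type*} {l : Filter ι} [l.NeBot] {C : Set H} (hne : C.Nonempty)
    (hcl : IsClosed C) (hcv : Convex ℝ C) {p : ι → H} (hp : ∀ k, p k ∈ C) {w : H}
    (h : ∀ v, Tendsto (fun k => ⟪p k, v⟫) l (𝓝 ⟪w, v⟫)) : w ∈ C := by
  obtain ⟨q, hq, hqv⟩ := exists_nearest hne hcl hcv w
  have h1 : ∀ k, ⟪p k, w - q⟫ ≤ ⟪q, w - q⟫ := fun k => by
    have := hqv (p k) (hp k)
    rw [real_inner_comm, inner_sub_left] at this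
    linarith
  have h2 : ⟪w, w - q⟫ ≤ ⟪q, w - q⟫ := le_of_tendsto' (h (w - q)) h1
  have h3 : ⟪w - q, w - q⟫ ≤ 0 := by rw [inner_sub_left]; linarith
  rw [real_inner_self_nonpos, sub_eq_zero] at h3
  rwa [h3]

namespace IsIteration

variable {L : H →L[ℝ] G} {C : Set H} {Q : Set G} {β α N : ℝ} {η : ℕ → ℝ}
  {U : ℕ → H →L[ℝ] H} {γ lam : ℕ → ℝ} {a b x : ℕ → H}

theorem exists_tendsto_inner_inverse (I : IsIteration L C Q β α N η U γ lam a b x) (v : H) :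
    ∃ l, Tendsto (fun k => ⟪(U k).inverse v, v⟫) atTop (𝓝 l) := by
  refine exists_tendsto_of_le_one_add_mul (fun k => (I.isMetric k).nonneg v) I.η_nonneg
    (fun _ => le_rfl) I.η_summable summable_zero fun k => ?_
  rw [add_zero]
  exact PosClass.inverse_le_of_le I.α_pos (I.mem k) (I.mem (k + 1)) (I.mono k) v

/-- The inverses of the metrics converge strongly. -/
theorem exists_tendsto_inverse (I : IsIteration L C Q β α N η U γ lam a b x) (d : H) :
    ∃ y, Tendsto (fun k => (U k).inverse d) atTop (𝓝 y) := by
  have hα := I.α_pos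
  set P : ℕ → ℝ := fun k => ∏ j ∈ Finset.range k, (1 + η j) with hP
  have hPs : ∀ k, P (k + 1) = (1 + η k) * P k := fun k => by
    rw [hP]; simp only []; rw [Finset.prod_range_succ, mul_comm]
  have hP1 : ∀ k, 1 ≤ P k := by
    intro k
    induction k with
    | zero => simp [hP]
    | succ k ih => rw [hPs]; nlinarith [I.η_nonneg k]
  have hP0 : ∀ k, 0 < P k := fun k => one_pos.trans_le (hP1 k)
  obtain ⟨l, hl⟩ := exists_tendsto_of_le_one_add_mul (fun k => (hP0 k).le) I.η_nonneg
    (fun _ => le_rfl) I.η_summable summable_zero (fun k => by rw [add_zero, hPs])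
  -- Dividing by `P k = ∏ (1 + η j)` makes the inverses decreasing in the Loewner order. Then `V m -
  -- V n` is positive for `m ≤ n`, and `norm_sq_apply_le_of_nonneg` makes `V k d` Cauchy because the
  -- scalars `⟪V k d, d⟫` are.
  set V : ℕ → H →L[ℝ] H := fun k => (P k)⁻¹ • (U k).inverse with hV
  have hVapp : ∀ k v, V k v = (P k)⁻¹ • (U k).inverse v := fun _ _ => rfl
  have hVin : ∀ k v, ⟪V k v, v⟫ = (P k)⁻¹ * ⟪(U k).inverse v, v⟫ := fun k v => by
    rw [hVapp, inner_smul_left]; rfl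
  have hanti : ∀ v, Antitone fun k => ⟪V k v, v⟫ := by
    intro v
    refine antitone_nat_of_succ_le fun k => ?_
    have h1 := PosClass.inverse_le_of_le hα (I.mem k) (I.mem (k + 1)) (I.mono k) v
    have h2 : (0 : ℝ) < 1 + η k := by linarith [I.η_nonneg k]
    have h3 := hP0 k
    rw [hVin, hVin, hPs, inv_mul_eq_div, inv_mul_eq_div, div_le_div_iff₀ (by positivity) h3]
    calc _ ≤ (1 + η k) * ⟪(U k).inverse v, v⟫ * P k := by gcongr
      _ = _ := by ring
  have hnorm : ∀ k, ‖V k‖ ≤ 1 / α := by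
    intro k
    refine (V k).opNorm_le_bound (by positivity) fun v => ?_
    rw [hVapp, norm_smul, Real.norm_of_nonneg (inv_pos.2 (hP0 k)).le]
    have h1 := (I.isMetric k).norm_apply_le v
    exact (mul_le_of_le_one_left (norm_nonneg _) (inv_le_one_of_one_le₀ (hP1 k))).trans h1
  have hdiff : ∀ m n, m ≤ n →
      ‖V m d - V n d‖ ^ 2 ≤ 2 / α * (⟪V m d, d⟫ - ⟪V n d, d⟫) := by
    intro m n hmn
    have hs : ∀ k v w, ⟪V k v, w⟫ = ⟪v, V k w⟫ := fun k v w => by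
      rw [hVapp, hVapp, inner_smul_left, inner_smul_right, (I.isMetric k).symm]; rfl
    have h := norm_sq_apply_le_of_nonneg (T := V m - V n)
      (fun v w => by
        rw [sub_apply, sub_apply, inner_sub_left, inner_sub_right, hs, hs])
      (fun v => by
        rw [sub_apply, inner_sub_left]
        linarith [hanti v hmn]) d
    rw [sub_apply, inner_sub_left] at h
    refine h.trans ?_
    have h2 : ‖V m - V n‖ ≤ 2 / α := by
      refine (norm_sub_le _ _).trans ?_
      have e : 2 / α = 1 / α + 1 / α := by ring
      rw [e]
      exact add_le_add (hnorm m) (hnorm n)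
    have h3 : 0 ≤ ⟪V m d, d⟫ - ⟪V n d, d⟫ := by linarith [hanti d hmn]
    gcongr
  have hq : CauchySeq fun k => ⟪V k d, d⟫ := by
    have hbdd : BddBelow (Set.range fun k => ⟪V k d, d⟫) := by
      refine ⟨0, ?_⟩
      rintro _ ⟨k, rfl⟩
      simp only [hVin]
      exact mul_nonneg (inv_pos.2 (hP0 k)).le ((I.isMetric k).nonneg d)
    exact (tendsto_atTop_ciInf (hanti d) hbdd).cauchySeq
  have hc : CauchySeq fun k => V k d := by
    rw [Metric.cauchySeq_iff'] at hq ⊢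
    intro ε hε
    obtain ⟨n₀, h₀⟩ := hq (ε ^ 2 / (2 / α)) (by positivity)
    refine ⟨n₀, fun n hn => ?_⟩
    have h1 := h₀ n hn
    have h2 := hdiff n₀ n hn
    rw [Real.dist_eq, abs_sub_comm] at h1
    rw [dist_comm, dist_eq_norm]
    refine lt_of_pow_lt_pow_left₀ 2 hε.le (h2.trans_lt ?_)
    rw [lt_div_iff₀ (by positivity), mul_comm] at h1
    refine lt_of_le_of_lt ?_ h1
    gcongr
    exact le_abs_self _
  obtain ⟨y, hy⟩ := cauchySeq_tendsto_of_complete hc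
  refine ⟨l • y, (hl.smul hy).congr fun k => ?_⟩
  rw [hVapp, smul_inv_smul₀ (hP0 k).ne']

/-- The square is at most `⟪B x, p - xs⟫ + ⟪B x, x - p⟫`. The variational inequality bounds `γ`
times the first product by `⟪U⁻¹ (x - p), p - xs⟫`, so with `γ ≥ g` both are `O(‖x - p‖)`. -/
theorem tendsto_norm_sub_mproj (I : IsIteration L C Q β α N η U γ lam a b x) {xs : H}
    (hxs : xs ∈ sfpSol L C Q) {g : ℝ} (hg : 0 < g) (hgγ : ∀ k, g ≤ γ k)
    (hres : Tendsto (fun k => residual L C Q (U k) (γ k) (x k)) atTop (𝓝 0)) :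
    Tendsto (fun k => ‖L (x k) - mproj Q (L (x k))‖) atTop (𝓝 0) := by
  obtain ⟨R, hR⟩ := I.exists_norm_le hxs
  have hα := I.α_pos
  have h1 : Tendsto (fun k => ‖L (x k) - mproj Q (L (x k))‖ ^ 2) atTop (𝓝 0) := by
    have h2 := hres.const_mul (1 / (α * g) * R + ‖L‖ ^ 2 * R)
    rw [mul_zero] at h2
    refine squeeze_zero (fun k => sq_nonneg _) (fun k => ?_) h2
    change _ ≤ _ * ‖x k - fwdBwd L C Q (U k) (γ k) (x k)‖
    refine (norm_sub_mproj_sq_le I.Q_ne I.Q_closed I.Q_convex hxs (x k)).trans ?_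
    have hK := (I.fwdBwd_solvesVI k).inner_forward_nonneg hα (I.mem k) hxs.1
    have hRk := hR k
    have hB := norm_sfpGrad_sub_le (L := L) I.Q_ne I.Q_closed I.Q_convex (x k) xs
    rw [sfpGrad_eq_zero I.Q_ne I.Q_closed I.Q_convex hxs, sub_zero] at hB
    set p := fwdBwd L C Q (U k) (γ k) (x k)
    set B := sfpGrad L Q (x k)
    have hR0 : 0 ≤ R := (norm_nonneg _).trans hRk.1
    have e : x k - xs = (p - xs) + (x k - p) := by abel
    rw [e, inner_add_right, add_mul]
    rw [inner_sub_left, inner_smul_left] at hK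
    simp only [RCLike.conj_to_real] at hK
    have h3 : ⟪(U k).inverse (x k - p), p - xs⟫ ≤ 1 / α * ‖x k - p‖ * R := by
      refine (real_inner_le_norm _ _).trans ?_
      gcongr
      · exact (I.isMetric k).norm_apply_le _
      · exact hRk.2
    have h4 : ⟪B, p - xs⟫ ≤ 1 / (α * g) * R * ‖x k - p‖ := by
      have hX : 0 ≤ 1 / (α * g) * R * ‖x k - p‖ := by positivity
      have hY : g * (1 / (α * g) * R * ‖x k - p‖) = 1 / α * ‖x k - p‖ * R := by field_simp
      by_contra! hlt
      have : g * (1 / (α * g) * R * ‖x k - p‖) < γ k * ⟪B, p - xs⟫ := by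
        calc _ < g * ⟪B, p - xs⟫ := by gcongr
          _ ≤ _ := by
            have := hX.trans hlt.le
            gcongr
            exact hgγ k
      linarith
    have h5 : ⟪B, x k - p⟫ ≤ ‖L‖ ^ 2 * R * ‖x k - p‖ := by
      refine (real_inner_le_norm _ _).trans ?_
      gcongr
      refine hB.trans ?_
      gcongr
      exact hRk.1
    exact add_le_add h4 h5
  have h2 := h1.sqrt
  simpa only [Real.sqrt_sq (norm_nonneg _), Real.sqrt_zero] using h2

theorem tendsto_sfpGrad (I : IsIteration L C Q β α N η U γ lam a b x) {xs : H}
    (hxs : xs ∈ sfpSol L C Q) {g : ℝ} (hg : 0 < g) (hgγ : ∀ k, g ≤ γ k)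
    (hres : Tendsto (fun k => residual L C Q (U k) (γ k) (x k)) atTop (𝓝 0)) :
    Tendsto (fun k => sfpGrad L Q (x k)) atTop (𝓝 (sfpGrad L Q xs)) := by
  rw [sfpGrad_eq_zero I.Q_ne I.Q_closed I.Q_convex hxs]
  have h := ((I.tendsto_norm_sub_mproj hxs hg hgγ hres).const_mul ‖L‖)
  rw [mul_zero] at h
  refine squeeze_zero_norm (fun k => ?_) h
  have := L.adjoint.le_opNorm (L (x k) - mproj Q (L (x k)))
  rwa [LinearIsometryEquiv.norm_map] at this

/-- The iterates share their weak limit with the points `p k` of `C`, and their images under `L`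
share theirs with projections onto `Q`. -/
theorem weak_limit_mem (I : IsIteration L C Q β α N η U γ lam a b x)
    (hΩ : (sfpSol L C Q).Nonempty) {g : ℝ} (hg : 0 < g) (hgγ : ∀ k, g ≤ γ k)
    (hres : Tendsto (fun k => residual L C Q (U k) (γ k) (x k)) atTop (𝓝 0))
    {f : Filter ℕ} [f.NeBot] (hf : f ≤ atTop) {w : H}
    (h : ∀ v, Tendsto (fun k => ⟪x k, v⟫) f (𝓝 ⟪w, v⟫)) : w ∈ sfpSol L C Q := by
  obtain ⟨xs, hxs⟩ := hΩ
  constructor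
  · exact mem_of_weak_limit I.C_ne I.C_closed I.C_convex (fun k => (I.fwdBwd_solvesVI k).1)
      (tendsto_inner_of_sub_tendsto_zero h (hres.mono_left hf))
  · refine mem_of_weak_limit I.Q_ne I.Q_closed I.Q_convex
      (fun k => (mproj_solvesVI I.Q_ne I.Q_closed I.Q_convex (L (x k))).1)
      (tendsto_inner_of_sub_tendsto_zero (fun v => ?_)
        ((I.tendsto_norm_sub_mproj hxs hg hgγ hres).mono_left hf))
    simpa only [ContinuousLinearMap.adjoint_inner_right] using h (L.adjoint v)

/-- Opial's argument: subtracting the squared distances to `w` and `w'` shows that `⟪x k, (U k)⁻¹ (w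
- w')⟫` converges. Strong convergence replaces the second argument by a fixed `y`, so `⟪w, y⟫ = ⟪w',
y⟫`, while `⟪y, w - w'⟫ ≥ ‖w - w'‖² / N`. -/
theorem weak_limit_unique (I : IsIteration L C Q β α N η U γ lam a b x)
    {f f' : Filter ℕ} [f.NeBot] [f'.NeBot] (hf : f ≤ atTop) (hf' : f' ≤ atTop) {w w' : H}
    (h : ∀ v, Tendsto (fun k => ⟪x k, v⟫) f (𝓝 ⟪w, v⟫))
    (h' : ∀ v, Tendsto (fun k => ⟪x k, v⟫) f' (𝓝 ⟪w', v⟫))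
    (hw : w ∈ sfpSol L C Q) (hw' : w' ∈ sfpSol L C Q) : w = w' := by
  obtain ⟨R, hR⟩ := I.exists_norm_le hw
  obtain ⟨y, hy⟩ := I.exists_tendsto_inverse (w - w')
  obtain ⟨l₁, h₁⟩ := I.exists_tendsto_wnorm hw
  obtain ⟨l₂, h₂⟩ := I.exists_tendsto_wnorm hw'
  obtain ⟨l₃, h₃⟩ := I.exists_tendsto_inner_inverse w
  obtain ⟨l₄, h₄⟩ := I.exists_tendsto_inner_inverse w'
  have hlim : Tendsto (fun k => ⟪x k, (U k).inverse (w - w')⟫) atTop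
      (𝓝 (1 / 2 * (l₃ - l₄ - (l₁ ^ 2 - l₂ ^ 2)))) := by
    refine (((h₃.sub h₄).sub ((h₁.pow 2).sub (h₂.pow 2))).const_mul (1 / 2)).congr fun k => ?_
    have hm := I.isMetric k
    rw [hm.wnorm_sq, hm.wnorm_sq, hm.inner_sub_self (x k), hm.inner_sub_self (x k), ← hm.symm,
      inner_sub_right]
    ring
  have hx : ∀ k, ‖x k‖ ≤ R + ‖w‖ := fun k => by
    have h5 := norm_add_le (x k - w) w
    rw [sub_add_cancel] at h5
    linarith [(hR k).1]
  have herr : Tendsto (fun k => ⟪x k, (U k).inverse (w - w') - y⟫) atTop (𝓝 0) := by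
    have h5 := (tendsto_iff_norm_sub_tendsto_zero.1 hy).const_mul (R + ‖w‖)
    rw [mul_zero] at h5
    refine squeeze_zero_norm (fun k => ?_) h5
    refine (norm_inner_le_norm _ _).trans ?_
    gcongr
    exact hx k
  have hy' : Tendsto (fun k => ⟪x k, y⟫) atTop
      (𝓝 (1 / 2 * (l₃ - l₄ - (l₁ ^ 2 - l₂ ^ 2)) - 0)) := by
    refine (hlim.sub herr).congr fun k => ?_
    rw [inner_sub_right, sub_sub_cancel]
  have e1 := tendsto_nhds_unique (h y) (hy'.mono_left hf)
  have e2 := tendsto_nhds_unique (h' y) (hy'.mono_left hf')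
  have e3 : ⟪y, w - w'⟫ = 0 := by
    rw [real_inner_comm, inner_sub_left, e1, e2, sub_self]
  have h6 : Tendsto (fun k => ⟪(U k).inverse (w - w'), w - w'⟫) atTop (𝓝 ⟪y, w - w'⟫) :=
    hy.inner tendsto_const_nhds
  have h7 := ge_of_tendsto' h6 fun k => (I.isMetric k).lower (w - w')
  rw [e3] at h7
  have hN := I.N_pos
  have h8 : ‖w - w'‖ ^ 2 ≤ 0 := nonpos_of_mul_nonpos_right h7 (by positivity)
  have h9 : ‖w - w'‖ = 0 := pow_eq_zero_iff two_ne_zero |>.1 (le_antisymm h8 (sq_nonneg _))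
  exact sub_eq_zero.1 (norm_eq_zero.1 h9)

theorem exists_tendsto_toWeakSpace (I : IsIteration L C Q β α N η U γ lam a b x)
    (hΩ : (sfpSol L C Q).Nonempty) {g : ℝ} (hg : 0 < g) (hgγ : ∀ k, g ≤ γ k)
    (hres : Tendsto (fun k => residual L C Q (U k) (γ k) (x k)) atTop (𝓝 0)) :
    ∃ xs ∈ sfpSol L C Q,
      Tendsto (fun k => toWeakSpace ℝ H (x k)) atTop (𝓝 (toWeakSpace ℝ H xs)) := by
  obtain ⟨z, hz⟩ := hΩ
  obtain ⟨R, hR⟩ := I.exists_norm_le hz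
  have hx : ∀ k, ‖x k‖ ≤ R + ‖z‖ := fun k => by
    have h5 := norm_add_le (x k - z) z
    rw [sub_add_cancel] at h5
    linarith [(hR k).1]
  choose w hw using exists_weak_limit hx
  have hmem : ∀ f : Ultrafilter ℕ, (f : Filter ℕ) ≤ atTop → w f ∈ sfpSol L C Q := fun f hf =>
    I.weak_limit_mem ⟨z, hz⟩ hg hgγ hres hf (hw f)
  set f₀ : Ultrafilter ℕ := Ultrafilter.of atTop
  have hf₀ : (f₀ : Filter ℕ) ≤ atTop := Ultrafilter.of_le _
  refine ⟨w f₀, hmem f₀ hf₀, tendsto_toWeakSpace_of_forall_inner fun v => ?_⟩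
  rw [tendsto_iff_ultrafilter]
  intro f hf
  rw [I.weak_limit_unique hf₀ hf (hw f₀) (hw f) (hmem f₀ hf₀) (hmem f hf)]
  exact hw f v

end IsIteration

end VMSFP

/-! ### The natural residual and the case of divergent relaxation sums. -/

namespace VMSFP

variable {H : Type*} [NormedAddCommGroup H] [InnerProductSpace ℝ H] [CompleteSpace H]
variable {G : Type*} [NormedAddCommGroup G] [InnerProductSpace ℝ G] [CompleteSpace G]

/-- The residual of the projected gradient map with unit step in the original metric. -/
def naturalResidual (L : H →L[ℝ] G) (C : Set H) (Q : Set G) (x : H) : ℝ :=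
  ‖x - mproj C (x - sfpGrad L Q x)‖

namespace IsIteration

variable {L : H →L[ℝ] G} {C : Set H} {Q : Set G} {β α N : ℝ} {η : ℕ → ℝ}
  {U : ℕ → H →L[ℝ] H} {γ lam : ℕ → ℝ} {a b x : ℕ → H}

/-- The Lipschitz bound involves neither `U k` nor `γ k`, so successive iterates can be compared
without tracking the metrics. -/
theorem naturalResidual_le (I : IsIteration L C Q β α N η U γ lam a b x) (v w : H) :
    naturalResidual L C Q v ≤ naturalResidual L C Q w + (2 + ‖L‖ ^ 2) * ‖v - w‖ := by
  have h1 := SolvesVI.dist_le IsMetric.id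
    (mproj_solvesVI I.C_ne I.C_closed I.C_convex (w - sfpGrad L Q w))
    (mproj_solvesVI I.C_ne I.C_closed I.C_convex (v - sfpGrad L Q v))
  rw [div_one, one_mul] at h1
  have h2 := norm_sfpGrad_sub_le (L := L) I.Q_ne I.Q_closed I.Q_convex v w
  have h3 : ‖w - sfpGrad L Q w - (v - sfpGrad L Q v)‖ ≤
      ‖v - w‖ + ‖sfpGrad L Q v - sfpGrad L Q w‖ := by
    have e : w - sfpGrad L Q w - (v - sfpGrad L Q v) =
        (sfpGrad L Q v - sfpGrad L Q w) - (v - w) := by abel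
    rw [e, add_comm]
    exact norm_sub_le _ _
  have e : v - mproj C (v - sfpGrad L Q v) = (w - mproj C (w - sfpGrad L Q w)) + (v - w) +
      (mproj C (w - sfpGrad L Q w) - mproj C (v - sfpGrad L Q v)) := by abel
  rw [naturalResidual, naturalResidual, e]
  refine (norm_add₃_le).trans ?_
  linarith

/-- The comparison of the residuals of one point for two metrics. -/
theorem residual_compare (I : IsIteration L C Q β α N η U γ lam a b x) (k : ℕ) :
    1 / N * residual L C Q (U k) (γ k) (x k) ^ 2 + γ k * naturalResidual L C Q (x k) ^ 2 ≤
      (1 + 2 * β) / α * (residual L C Q (U k) (γ k) (x k) * naturalResidual L C Q (x k)) := by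
  have hα := I.α_pos
  -- Each projection inequality is tested at the other projection; after weighting the second by `γ
  -- k`, the gradient terms cancel.
  have h1 := (I.fwdBwd_solvesVI k).inner_forward_nonneg hα (I.mem k)
    (mproj_solvesVI I.C_ne I.C_closed I.C_convex (x k - sfpGrad L Q (x k))).1
  have h2 := (mproj_solvesVI I.C_ne I.C_closed I.C_convex (x k - sfpGrad L Q (x k))).2 _
    (I.fwdBwd_solvesVI k).1
  change 1 / N * ‖x k - fwdBwd L C Q (U k) (γ k) (x k)‖ ^ 2 + _ ≤
    _ * (‖x k - fwdBwd L C Q (U k) (γ k) (x k)‖ * _)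
  rw [naturalResidual]
  set p := fwdBwd L C Q (U k) (γ k) (x k)
  set q := mproj C (x k - sfpGrad L Q (x k))
  set B := sfpGrad L Q (x k)
  have e1 : p - q = (x k - q) - (x k - p) := by abel
  have e2 : x k - B - q = (x k - q) - B := by abel
  rw [e1] at h1 h2
  rw [e2] at h2
  have hlow := (I.isMetric k).lower (x k - p)
  have hup : ⟪(U k).inverse (x k - p), x k - q⟫ ≤ 1 / α * ‖x k - p‖ * ‖x k - q‖ := by
    refine (real_inner_le_norm _ _).trans ?_
    gcongr
    exact (I.isMetric k).norm_apply_le _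
  have hγu : γ k * ‖x k - p‖ ≤ 2 * β / α * ‖x k - p‖ := by
    have h3 := PosClass.mul_norm_le (I.mem k) (x k - p)
    have h4 := mul_le_mul_of_nonneg_left h3 (I.γ_pos k).le
    have h5 := mul_le_mul_of_nonneg_right (I.γ_lt k).le (norm_nonneg (x k - p))
    rw [div_mul_eq_mul_div, le_div_iff₀ hα]
    linarith
  have hin : γ k * ⟪x k - q, x k - p⟫ ≤ 2 * β / α * ‖x k - p‖ * ‖x k - q‖ := by
    calc γ k * ⟪x k - q, x k - p⟫ ≤ γ k * (‖x k - q‖ * ‖x k - p‖) :=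
          mul_le_mul_of_nonneg_left (real_inner_le_norm _ _) (I.γ_pos k).le
      _ = γ k * ‖x k - p‖ * ‖x k - q‖ := by ring
      _ ≤ _ := by gcongr
  generalize x k - p = u at *
  generalize x k - q = v at *
  have h3 := mul_nonpos_of_nonneg_of_nonpos (I.γ_pos k).le h2
  simp only [inner_sub_left, inner_sub_right, inner_smul_left, RCLike.conj_to_real,
    real_inner_self_eq_norm_sq] at h1 h3
  have e3 : (1 + 2 * β) / α * (‖u‖ * ‖v‖) =
      1 / α * ‖u‖ * ‖v‖ + 2 * β / α * ‖u‖ * ‖v‖ := by ring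
  rw [e3]
  linarith

theorem residual_le_naturalResidual (I : IsIteration L C Q β α N η U γ lam a b x) (k : ℕ) :
    residual L C Q (U k) (γ k) (x k) ≤
      N * ((1 + 2 * β) / α) * naturalResidual L C Q (x k) := by
  have h := I.residual_compare k
  have hN := I.N_pos
  have hα := I.α_pos
  have hβ := I.β_pos
  have h0 : 0 ≤ residual L C Q (U k) (γ k) (x k) := norm_nonneg _
  have h0' : 0 ≤ naturalResidual L C Q (x k) := norm_nonneg _
  generalize residual L C Q (U k) (γ k) (x k) = r at *
  generalize naturalResidual L C Q (x k) = s at *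
  rcases h0.eq_or_lt with h1 | h1
  · rw [← h1]; positivity
  · have h2 : 0 ≤ γ k * s ^ 2 := mul_nonneg (I.γ_pos k).le (sq_nonneg _)
    have h3 : 1 / N * r * r ≤ (1 + 2 * β) / α * s * r := by nlinarith
    have h4 := le_of_mul_le_mul_right h3 h1
    rw [div_mul_eq_mul_div, one_mul, div_le_iff₀ hN] at h4
    linarith

theorem naturalResidual_le_residual (I : IsIteration L C Q β α N η U γ lam a b x) {g : ℝ}
    (hg : 0 < g) (hgγ : ∀ k, g ≤ γ k) (k : ℕ) :
    naturalResidual L C Q (x k) ≤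
      (1 + 2 * β) / α / g * residual L C Q (U k) (γ k) (x k) := by
  have h := I.residual_compare k
  have hN := I.N_pos
  have hα := I.α_pos
  have hβ := I.β_pos
  have h0 : 0 ≤ residual L C Q (U k) (γ k) (x k) := norm_nonneg _
  have h0' : 0 ≤ naturalResidual L C Q (x k) := norm_nonneg _
  generalize residual L C Q (U k) (γ k) (x k) = r at *
  generalize naturalResidual L C Q (x k) = s at *
  rcases h0'.eq_or_lt with h1 | h1
  · rw [← h1]; positivity
  · have h2 : 0 ≤ 1 / N * r ^ 2 := by positivity
    have h5 : g * s ^ 2 ≤ γ k * s ^ 2 := by gcongr; exact hgγ k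
    have h3 : g * s * s ≤ (1 + 2 * β) / α * r * s := by nlinarith
    have h4 := le_of_mul_le_mul_right h3 h1
    rw [div_mul_eq_mul_div, le_div_iff₀ hg]
    linarith

theorem tendsto_residual_of_not_summable (I : IsIteration L C Q β α N η U γ lam a b x)
    (hΩ : (sfpSol L C Q).Nonempty) {g ε : ℝ} (hg : 0 < g) (hε : 0 < ε) (hgγ : ∀ k, g ≤ γ k)
    (hγε : ∀ k, γ k * ‖U k‖ ≤ 2 * β - ε) (hdiv : ¬ Summable lam) :
    Tendsto (fun k => residual L C Q (U k) (γ k) (x k)) atTop (𝓝 0) := by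
  obtain ⟨xs, hxs⟩ := hΩ
  obtain ⟨R, hR⟩ := I.exists_norm_le hxs
  obtain ⟨e, hes, he⟩ := I.exists_error
  have hα := I.α_pos
  have hβ := I.β_pos
  have hN := I.N_pos
  set c₁ := N * ((1 + 2 * β) / α)
  set c₂ := (1 + 2 * β) / α / g
  have hc₁ : 0 < c₁ := by positivity
  have hc₂ : 0 < c₂ := by positivity
  have hrρ : ∀ k, residual L C Q (U k) (γ k) (x k) ≤ c₁ * naturalResidual L C Q (x k) :=
    I.residual_le_naturalResidual
  have hρr : ∀ k, naturalResidual L C Q (x k) ≤ c₂ * residual L C Q (U k) (γ k) (x k) :=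
    I.naturalResidual_le_residual hg hgγ
  have hρ : ∀ k, 0 ≤ naturalResidual L C Q (x k) := fun k => norm_nonneg _
  have hrR : ∀ k, residual L C Q (U k) (γ k) (x k) ≤ 2 * R := by
    intro k
    have e1 : x k - fwdBwd L C Q (U k) (γ k) (x k) =
        (x k - xs) - (fwdBwd L C Q (U k) (γ k) (x k) - xs) := by abel
    change ‖x k - fwdBwd L C Q (U k) (γ k) (x k)‖ ≤ 2 * R
    rw [e1]
    refine (norm_sub_le _ _).trans ?_
    linarith [(hR k).1, (hR k).2]
  suffices h : Tendsto (fun k => naturalResidual L C Q (x k)) atTop (𝓝 0) by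
    have h2 := h.const_mul c₁
    rw [mul_zero] at h2
    exact squeeze_zero (fun k => norm_nonneg _) hrρ h2
  refine tendsto_zero_of_summable_indicator (lam := lam) (e := fun k => lam k * ‖e k‖)
    (K := (2 + ‖L‖ ^ 2) * (c₁ + 1)) (R := c₂ * (2 * R)) (c := 2) hρ
    (fun k => (hρr k).trans (by gcongr; exact hrR k)) (by positivity) (fun k => (I.lam_pos k).le)
    I.lam_le_two (fun k => mul_nonneg (I.lam_pos k).le (norm_nonneg _)) hes (fun k => ?_)
    (fun δ hδ => ?_) hdiv
  · refine (I.naturalResidual_le (x (k + 1)) (x k)).trans ?_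
    rw [mul_assoc]
    have hl := (I.lam_pos k).le
    have h1 : ‖x (k + 1) - x k‖ ≤
        lam k * (c₁ * naturalResidual L C Q (x k)) + lam k * ‖e k‖ := by
      have e1 : x (k + 1) - x k = lam k • e k -
          lam k • (x k - fwdBwd L C Q (U k) (γ k) (x k)) := by rw [he]; abel
      rw [e1, add_comm]
      refine (norm_sub_le _ _).trans ?_
      rw [norm_smul, norm_smul, Real.norm_of_nonneg hl]
      have := hrρ k
      change ‖x k - fwdBwd L C Q (U k) (γ k) (x k)‖ ≤ _ at this
      gcongr
    have h2 : lam k * (c₁ * naturalResidual L C Q (x k)) + lam k * ‖e k‖ ≤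
        (c₁ + 1) * (lam k * naturalResidual L C Q (x k) + lam k * ‖e k‖) := by
      have h3 := mul_nonneg hl (hρ k)
      have h4 := mul_nonneg hc₁.le (mul_nonneg hl (norm_nonneg (e k)))
      linarith
    gcongr
    exact h1.trans h2
  -- Where the natural residual is at least `δ`, the residual is at least `δ / c₂` and the slack at
  -- least `σ`, so `lam k` is at most the summable decrease divided by `2 * σ`.
  · obtain ⟨σ, hσ, hσs⟩ := exists_le_slack (H := H) (C := C) (R := R) hα hβ hg hε hN
      (div_pos hδ hc₂)
    refine Summable.of_nonneg_of_le (fun k => Set.indicator_nonneg (fun k _ => (I.lam_pos k).le) k)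
      (fun k => ?_) ((I.summable_decrease hxs).mul_left (1 / (2 * σ)))
    have h1 := mul_nonneg (I.relax_nonneg k)
      (sq_nonneg (wnorm (U k).inverse (x k - fwdBwd L C Q (U k) (γ k) (x k))))
    have h2 := mul_nonneg (I.lam_pos k).le (I.slack_nonneg hxs k)
    rw [div_mul_eq_mul_div, one_mul, le_div_iff₀ (by positivity)]
    by_cases hk : δ ≤ naturalResidual L C Q (x k)
    · rw [Set.indicator_of_mem (s := {k | δ ≤ naturalResidual L C Q (x k)}) hk]
      have h3 : δ / c₂ ≤ ‖x k - fwdBwd L C Q (U k) (γ k) (x k)‖ := by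
        rw [div_le_iff₀ hc₂, mul_comm]
        exact hk.trans (hρr k)
      have h4 := hσs (U k) (γ k) (x k) _ xs _ (hgγ k) (hγε k) (I.norm_le k) (I.mem k)
        (I.fwdBwd_solvesVI k) hxs.1 (I.cocoercive hxs _) (hR k).2 h3
      have h5 := mul_le_mul_of_nonneg_left h4 (I.lam_pos k).le
      linarith
    · rw [Set.indicator_of_notMem (s := {k | δ ≤ naturalResidual L C Q (x k)}) hk, zero_mul]
      linarith

end IsIteration

end VMSFP

end

theorem theorem4p3
    {H G : Type*} [NormedAddCommGroup H] [InnerProductSpace ℝ H] [CompleteSpace H]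
    [NormedAddCommGroup G] [InnerProductSpace ℝ G] [CompleteSpace G]
    -- the split feasibility problem, assumed solvable
    (L : H →L[ℝ] G) (C : Set H) (Q : Set G)
    (hCne : C.Nonempty) (hCcl : IsClosed C) (hCcv : Convex ℝ C)
    (hQne : Q.Nonempty) (hQcl : IsClosed Q) (hQcv : Convex ℝ Q)
    (hΩ : (VMSFP.sfpSol L C Q).Nonempty)
    -- for `L ≠ 0` the second condition reads `β ≤ 1 / ‖L‖ ^ 2`, with `β = 1 / ‖L‖ ^ 2` allowed
    (β : ℝ) (hβ : 0 < β) (hβL : β * ‖L‖ ^ 2 ≤ 1)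
    -- the variable metrics
    (α : ℝ) (hα : 0 < α) (η : ℕ → ℝ) (hη : ∀ k, 0 ≤ η k) (hηs : Summable η)
    (U : ℕ → H →L[ℝ] H) (hU : ∀ k, U k ∈ VMSFP.PosClass H α)
    (μ : ℝ) (hμ : IsLUB (Set.range fun k => ‖U k‖) μ)
    (hUm : ∀ k, U k ≤ (1 + η k) • U (k + 1))
    -- step sizes `γ k ∈ (0, 2β / ‖U k‖)`, relaxation parameters, errors
    (γ lam : ℕ → ℝ) (hγ : ∀ k, 0 < γ k ∧ γ k * ‖U k‖ < 2 * β)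
    (hlam : ∀ k, 0 < lam k ∧ lam k < 1 / VMSFP.avgConst β (γ k) (U k))
    (a b : ℕ → H) (ha : Summable fun k => lam k * ‖a k‖) (hb : Summable fun k => lam k * ‖b k‖)
    -- the iteration, from an arbitrary starting point `x 0`
    (x y : ℕ → H)
    (hy : ∀ k, y k = x k - γ k • U k (VMSFP.sfpGrad L Q (x k) + b k))
    (hx : ∀ k, x (k + 1) = x k + lam k • (VMSFP.wproj (U k).inverse C (y k) + a k - x k)) :
    -- (i)
    (∀ xs ∈ VMSFP.sfpSol L C Q, ∃ l : ℝ,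
      Tendsto (fun k => VMSFP.wnorm (U k).inverse (x k - xs)) atTop (𝓝 l)) ∧
    -- (ii), (iii), (iv) for relaxation parameters bounded away from both ends
    (∀ lamLow τ : ℝ, 0 < lamLow → 0 < τ →
      (∀ k, lamLow ≤ lam k ∧ lam k ≤ 1 / VMSFP.avgConst β (γ k) (U k) - τ) →
      Tendsto (fun k => VMSFP.residual L C Q (U k) (γ k) (x k)) atTop (𝓝 0) ∧
      ∀ γLow : ℝ, 0 < γLow → (∀ k, γLow ≤ γ k) →
        (∃ xs ∈ VMSFP.sfpSol L C Q,
          Tendsto (fun k => toWeakSpace ℝ H (x k)) atTop (𝓝 (toWeakSpace ℝ H xs))) ∧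
        ∀ ε : ℝ, 0 < ε → (∀ k, γ k * μ ≤ 2 * β - ε) →
          ∀ xs ∈ VMSFP.sfpSol L C Q,
            Tendsto (fun k => VMSFP.sfpGrad L Q (x k)) atTop (𝓝 (VMSFP.sfpGrad L Q xs))) ∧
    -- (ii), (iii), (iv) for relaxation parameters subject only to a divergence condition
    (∀ γLow ε : ℝ, 0 < γLow → 0 < ε →
      Tendsto (fun n => ∑ k ∈ Finset.range n,
        lam k * (1 / VMSFP.avgConst β (γ k) (U k) - lam k)) atTop atTop →
      (∀ k, γLow ≤ γ k ∧ γ k * μ ≤ 2 * β - ε) →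
      (Summable fun k => |γ (k + 1) - γ k|) →
      (Summable fun k => |γ (k + 1) * ‖U (k + 1)‖ - γ k * ‖U k‖|) →
      (∀ v : H, Summable fun k => ‖(U k).inverse v - (U (k + 1)).inverse v‖) →
      Tendsto (fun k => VMSFP.residual L C Q (U k) (γ k) (x k)) atTop (𝓝 0) ∧
      (∃ xs ∈ VMSFP.sfpSol L C Q,
        Tendsto (fun k => toWeakSpace ℝ H (x k)) atTop (𝓝 (toWeakSpace ℝ H xs))) ∧
      ∀ lamLow : ℝ, 0 < lamLow → (∀ k, lamLow ≤ lam k) →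
        ∀ xs ∈ VMSFP.sfpSol L C Q,
          Tendsto (fun k => VMSFP.sfpGrad L Q (x k)) atTop (𝓝 (VMSFP.sfpGrad L Q xs))) := by
  have hμ0 : 0 ≤ μ := (norm_nonneg (U 0)).trans (hμ.1 ⟨0, rfl⟩)
  have I : VMSFP.IsIteration L C Q β α (μ + 1) η U γ lam a b x :=
    { C_ne := hCne, C_closed := hCcl, C_convex := hCcv, Q_ne := hQne, Q_closed := hQcl
      Q_convex := hQcv, β_pos := hβ, β_le := hβL, α_pos := hα, N_pos := by positivity
      η_nonneg := hη, η_summable := hηs, mem := hU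
      norm_le := fun k => (hμ.1 ⟨k, rfl⟩).trans (by linarith)
      mono := hUm, γ_pos := fun k => (hγ k).1, γ_lt := fun k => (hγ k).2
      lam_pos := fun k => (hlam k).1, lam_lt := fun k => (hlam k).2
      a_summable := ha, b_summable := hb
      step := fun k => by rw [hx, hy] }
  refine ⟨fun xs hxs => I.exists_tendsto_wnorm hxs, fun lamLow τ hl hτ h => ?_,
    fun γLow ε hg hε hdiv h _ _ _ => ?_⟩
  · have hres := I.tendsto_residual_of_le hΩ hl hτ h
    exact ⟨hres, fun γLow hg hgγ => ⟨I.exists_tendsto_toWeakSpace hΩ hg hgγ hres,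
      fun _ _ _ xs hxs => I.tendsto_sfpGrad hxs hg hgγ hres⟩⟩
  -- The terms of the divergent series are at most `2 * lam k`.
  · have hnot : ¬ Summable lam := by
      intro hs
      have hs' : Summable fun k => lam k * (1 / VMSFP.avgConst β (γ k) (U k) - lam k) := by
        refine Summable.of_nonneg_of_le I.relax_nonneg (fun k => ?_) (hs.mul_right 2)
        have h1 := I.avgConst_inv_bounds k
        have h2 := (hlam k).1
        exact mul_le_mul_of_nonneg_left (by linarith) h2.le
      exact not_tendsto_atTop_of_tendsto_nhds hs'.hasSum.tendsto_sum_nat hdiv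
    have hγε : ∀ k, γ k * ‖U k‖ ≤ 2 * β - ε := fun k =>
      (mul_le_mul_of_nonneg_left (hμ.1 ⟨k, rfl⟩) (hγ k).1.le).trans (h k).2
    have hres := I.tendsto_residual_of_not_summable hΩ hg hε (fun k => (h k).1) hγε hnot
    exact ⟨hres, I.exists_tendsto_toWeakSpace hΩ hg (fun k => (h k).1) hres,
      fun _ _ _ xs hxs => I.tendsto_sfpGrad hxs hg (fun k => (h k).1) hres⟩
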